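/- Let $C=\mathrm{Gal}(\mathbb C/\mathbb R)$, a group of order two, and let $\sigma$ be its sign representation on $\mathbb R$. *The spaces $\mathbf{KR}(V)$.* Let $s=C_0(\mathbb R,\mathbb C)$, graded by even and odd functions. For a $\mathbb Z/2$-graded complex $C^*$-algebra $A$, let $C^*_{\mathrm{gr}}(s,A)$ be the space of graded $*$-homomorphisms $s\to A$ with the topology of pointwise convergence, based at the zero homomorphism. For a finite-dimensional real inner product space $V$, let $\mathrm{Cl}(V)$ be the complex Clifford algebra generated by elements $[v]$, $\mathbb R$-linear in $v\in V$, with $[v]^2=|v|^2\cdot 1$; it has the grading involution $\alpha$ ($\mathbb C$-linear, multiplicative, $\alpha[v]=-[v]$), the $*$-involution (conjugate-linear, anti-multiplicative, $[v]^*=[v]$) and the involution $\psi$ (conjugate-linear, multiplicative, $\psi[v]=[v]$). Let $\mathcal H_V$ be the Hilbert space completion of $\mathrm{Sym}(V_{\mathbb C})$ for the inner product with distinct symmetric powers orthogonal, $\langle 1,1\rangle=1$ and $\langle v_1\cdots v_k,w_1\cdots w_k\rangle=\sum_{\pi\in\Sigma_k}\prod_i\langle v_i,w_{\pi(i)}\rangle$,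 let $\mathcal K_V$ be the $C^*$-algebra of compact operators on $\mathcal H_V$, concentrated in even degree, and let $(-)^\psi$ be conjugation of operators by the complex conjugation of $\mathcal H_V$. Set $$\mathbf{KR}(V)=C^*_{\mathrm{gr}}(s,\mathrm{Cl}(V)\otimes_{\mathbb C}\mathcal K_V),$$ with the involution $h\mapsto(\psi\otimes(-)^\psi)\circ h\circ(-)^*$, where $(-)^*$ is pointwise complex conjugation on $s$. If $V$ is an orthogonal $C$-representation, $C$ acts on $\mathbf{KR}(V)$ diagonally, through this involution and by functoriality in $V$. The unit map $\eta_V\colon S^V\to\mathbf{KR}(V)$ sends $\infty$ to the zero homomorphism and $v\in V$ to $f\mapsto f[v]\otimes p_0$, where $f[v]=f(|v|)\cdot 1$ for even $f$, $f[v]=\frac{f(|v|)}{|v|}[v]$ for odd $f$ (and $0$ if $v=0$), and $p_0$ is the orthogonal projection onto the constant summand of the symmetric algebra. The multiplication $\mathbf{KR}(V)\wedge\mathbf{KR}(W)\to\mathbf{KR}(V\oplus W)$ sends $(f,g)$ to $(f\otimes g)\circ\Delta$, where $\Delta\colon s\to s\mathbin{\hat\otimes}s$ is the graded $*$-homomorphism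 with $\Delta(u)=u\otimes u$ and $\Delta(v)=u\otimes v+v\otimes u$ for $u(x)=e^{-x^2}$ and $v(x)=xe^{-x^2}$, composed with the isomorphisms $\mathrm{Cl}(V)\mathbin{\hat\otimes}\mathrm{Cl}(W)\cong\mathrm{Cl}(V\oplus W)$ and $\mathcal K_V\otimes\mathcal K_W\cong\mathcal K_{V\oplus W}$. These data form the commutative orthogonal $C$-ring spectrum $\mathbf{KR}$. *Homotopy groups.* For an orthogonal $C$-representation $W$, let $$\pi_{-W}^C(\mathbf{KR})=\operatorname{colim}_U\,[S^U,\mathbf{KR}(U\oplus W)]^C_*,$$ the colimit, over the finite-dimensional orthogonal $C$-representations $U$, of the sets of equivariant based homotopy classes, along the stabilization maps given by multiplication with the unit maps. The multiplication of $\mathbf{KR}$ induces products $\pi_{-W}^C(\mathbf{KR})\times\pi_{-W'}^C(\mathbf{KR})\to\pi_{-(W\oplus W')}^C(\mathbf{KR})$. The pre-Euler class $a=a_\sigma\in\pi_{-\sigma}^C(\mathbf{KR})$ is the class of the composite $S^0=\{0,\infty\}\hookrightarrow S^\sigma\xrightarrow{\eta_\sigma}\mathbf{KR}(\sigma)$.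 **Theorem.** The relation $a^3=0$ holds in $\pi_{-3\sigma}^C(\mathbf{KR})$. Moreover, the fixed point space $$\left(C^*_{\mathrm{gr}}(s,\mathrm{Cl}(3\sigma))\right)^C=\{h\in C^*_{\mathrm{gr}}(s,\mathrm{Cl}(3\sigma)) : h=\mathrm{Cl}(-\mathrm{Id})\circ\psi\circ h\circ(-)^*\}$$ is homeomorphic to a circle. -/

import Mathlib

/-! Real-global K-theory and the cube of the pre-Euler class of the sign representation -/

set_option linter.unusedSectionVars false

open scoped TensorProduct ComplexConjugate InnerProductSpace ZeroAtInfty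

noncomputable section

namespace KRSpec

/-! ### Graded *-homomorphisms out of `s = C₀(ℝ, ℂ)` -/

/-- The grading involution of `s = C₀(ℝ, ℂ)`: it sends `f` to `x ↦ f (-x)`, so that its `+1` and
`-1` eigenspaces are the even and the odd functions. -/
def sGrading (f : C₀(ℝ, ℂ)) : C₀(ℝ, ℂ) :=
  f.comp ⟨⟨fun x => -x, continuous_neg⟩, (Homeomorph.neg ℝ).isClosedEmbedding.tendsto_cocompact⟩

@[simp] lemma sGrading_apply (f : C₀(ℝ, ℂ)) (x : ℝ) : sGrading f x = f (-x) := rfl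

/-- `CstarGr A α` is the set of graded *-homomorphisms `s → A`, for a complex *-algebra `A` which is
`ℤ/2`-graded by the involution `α`. -/
def CstarGr (A : Type*) [NonUnitalNonAssocSemiring A] [Module ℂ A] [Star A] (α : A → A) : Type _ :=
  {h : C₀(ℝ, ℂ) →⋆ₙₐ[ℂ] A // ∀ f, h (sGrading f) = α (h f)}

/-- The topology of pointwise convergence. -/
instance (A : Type*) [NonUnitalNonAssocSemiring A] [Module ℂ A] [Star A] [TopologicalSpace A]
    (α : A → A) : TopologicalSpace (CstarGr A α) :=
  TopologicalSpace.induced (fun h (f : C₀(ℝ, ℂ)) => h.1 f) inferInstance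

lemma tendsto_pow_mul_exp (n : ℕ) :
    Filter.Tendsto (fun x : ℝ => ((x ^ n * Real.exp (-x ^ 2) : ℝ) : ℂ)) (Filter.cocompact ℝ)
      (nhds 0) := by
  rw [tendsto_zero_iff_norm_tendsto_zero]
  have h := tendsto_rpow_abs_mul_exp_neg_mul_sq_cocompact (a := 1) one_pos n
  refine h.congr fun x => ?_
  rw [Complex.norm_real, norm_mul, norm_pow, Real.rpow_natCast, Real.norm_eq_abs,
    Real.norm_eq_abs, Real.abs_exp]
  simp

/-- The function `exp (-x²)`, an even element of `s`. -/
def uFun : C₀(ℝ, ℂ) where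
  toFun x := ((Real.exp (-x ^ 2) : ℝ) : ℂ)
  continuous_toFun := by fun_prop
  zero_at_infty' := by simpa using tendsto_pow_mul_exp 0

/-- The function `x * exp (-x²)`, an odd element of `s`. -/
def vFun : C₀(ℝ, ℂ) where
  toFun x := ((x * Real.exp (-x ^ 2) : ℝ) : ℂ)
  continuous_toFun := by fun_prop
  zero_at_infty' := by simpa using tendsto_pow_mul_exp 1

/-! ### Complex Clifford algebras -/

section Clifford

variable (V : Type) [NormedAddCommGroup V] [InnerProductSpace ℝ V]

/-- The quadratic form `v ↦ |v|²`. -/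
def normSqForm : QuadraticForm ℝ V := LinearMap.BilinMap.toQuadraticMap (innerₗ V)

@[simp] lemma normSqForm_apply (v : V) : normSqForm V v = ‖v‖ ^ 2 := by
  simp [normSqForm]

/-- The complex Clifford algebra `Cl V = ℂ ⊗ (T V / (v ⊗ v - |v|²))`. -/
def Cl : Type := ℂ ⊗[ℝ] CliffordAlgebra (normSqForm V)

instance : Ring (Cl V) := inferInstanceAs (Ring (ℂ ⊗[ℝ] CliffordAlgebra (normSqForm V)))
instance : Algebra ℂ (Cl V) := inferInstanceAs (Algebra ℂ (ℂ ⊗[ℝ] CliffordAlgebra (normSqForm V)))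

variable {V}

/-- The element `z ⊗ c` of `Cl V`. -/
def Cl.mk (z : ℂ) (c : CliffordAlgebra (normSqForm V)) : Cl V := z ⊗ₜ[ℝ] c

/-- The `ℝ`-linear inclusion `v ↦ [v]` of `V` into `Cl V`. -/
def Cl.ι (v : V) : Cl V := Cl.mk 1 (CliffordAlgebra.ι (normSqForm V) v)

@[elab_as_elim]
lemma Cl.induction {P : Cl V → Prop} (x : Cl V) (h0 : P 0)
    (h1 : ∀ (z : ℂ) (c : CliffordAlgebra (normSqForm V)), P (Cl.mk z c))
    (h2 : ∀ x y, P x → P y → P (x + y)) : P x :=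
  TensorProduct.induction_on (motive := P) x h0 h1 h2

lemma Cl.mk_mul_mk (z w : ℂ) (c d : CliffordAlgebra (normSqForm V)) :
    Cl.mk z c * Cl.mk w d = Cl.mk (z * w) (c * d) :=
  Algebra.TensorProduct.tmul_mul_tmul (R := ℝ) z w c d

lemma Cl.smul_mk (z w : ℂ) (c : CliffordAlgebra (normSqForm V)) :
    z • Cl.mk w c = Cl.mk (z * w) c := rfl

lemma Cl.one_def : (1 : Cl V) = Cl.mk 1 1 := rfl

/-- Complex conjugation of `ℂ` as an `ℝ`-algebra automorphism. -/
abbrev cconj : ℂ →ₐ[ℝ] ℂ := Complex.conjAe.toAlgHom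

/-- The map underlying the *-involution, `z ⊗ v₁⋯vₙ ↦ conj z ⊗ vₙ⋯v₁`. -/
def Cl.starHom : Cl V →+ Cl V :=
  (TensorProduct.map cconj.toLinearMap CliffordAlgebra.reverse :
    ℂ ⊗[ℝ] CliffordAlgebra (normSqForm V) →ₗ[ℝ] ℂ ⊗[ℝ] CliffordAlgebra (normSqForm V)).toAddMonoidHom

/-- The *-involution: the conjugate-linear anti-automorphism with `[v]* = [v]`. -/
instance : Star (Cl V) where
  star x := Cl.starHom x

lemma Cl.star_mk (z : ℂ) (c : CliffordAlgebra (normSqForm V)) :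
    star (Cl.mk z c) = Cl.mk (conj z) (CliffordAlgebra.reverse c) := rfl

lemma Cl.star_add' (x y : Cl V) : star (x + y) = star x + star y := map_add Cl.starHom x y

lemma Cl.star_zero' : star (0 : Cl V) = 0 := map_zero Cl.starHom

instance : StarRing (Cl V) where
  star_involutive x := by
    induction x using Cl.induction with
    | h0 => simp only [Cl.star_zero']
    | h1 z c => simp [Cl.star_mk]
    | h2 x y hx hy => simp only [Cl.star_add', hx, hy]
  star_mul x y := by
    induction x using Cl.induction with
    | h0 => simp only [zero_mul, mul_zero, Cl.star_zero']
    | h1 z c =>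
      induction y using Cl.induction with
      | h0 => simp only [zero_mul, mul_zero, Cl.star_zero']
      | h1 w d =>
        simp only [Cl.star_mk, Cl.mk_mul_mk, map_mul, CliffordAlgebra.reverse.map_mul]
        rw [mul_comm (conj z)]
      | h2 x y hx hy => simp only [mul_add, add_mul, Cl.star_add', hx, hy]
    | h2 x y hx hy => simp only [mul_add, add_mul, Cl.star_add', hx, hy]
  star_add := Cl.star_add'

instance : StarModule ℂ (Cl V) where
  star_smul z x := by
    induction x using Cl.induction with
    | h0 => simp
    | h1 w c => simp [Cl.star_mk, Cl.smul_mk]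
    | h2 x y hx hy => simp only [smul_add, star_add, hx, hy]

/-- For a finite-dimensional `V` the algebra `Cl V` is finite-dimensional; it carries the coarsest
topology that makes all linear functionals continuous, which is the topology of any norm. -/
instance : TopologicalSpace (Cl V) :=
  ⨅ l : Module.Dual ℂ (Cl V), TopologicalSpace.induced l inferInstance

/-- The grading involution: the `ℂ`-algebra endomorphism with `α [v] = -[v]`. -/
def Cl.α : Cl V →ₐ[ℂ] Cl V :=
  (Algebra.TensorProduct.map (AlgHom.id ℂ ℂ) CliffordAlgebra.involute :
    ℂ ⊗[ℝ] CliffordAlgebra (normSqForm V) →ₐ[ℂ] ℂ ⊗[ℝ] CliffordAlgebra (normSqForm V))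

/-- The ring homomorphism underlying `ψ`. -/
def Cl.ψHom : Cl V →+* Cl V :=
  (Algebra.TensorProduct.map cconj (AlgHom.id ℝ _) :
    ℂ ⊗[ℝ] CliffordAlgebra (normSqForm V) →ₐ[ℝ] ℂ ⊗[ℝ] CliffordAlgebra (normSqForm V)).toRingHom

lemma Cl.ψHom_mk (z : ℂ) (c : CliffordAlgebra (normSqForm V)) :
    Cl.ψHom (Cl.mk z c) = Cl.mk (conj z) c := rfl

/-- The conjugate-linear multiplicative involution with `ψ [v] = [v]`. -/
def Cl.ψ : Cl V →ₛₗ[starRingEnd ℂ] Cl V where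
  toFun := Cl.ψHom
  map_add' := map_add _
  map_smul' z x := by
    induction x using Cl.induction with
    | h0 => simp
    | h1 w c => simp [Cl.smul_mk, Cl.ψHom_mk]
    | h2 x y hx hy => simp only [smul_add, map_add, hx, hy]

lemma Cl.α_mk (z : ℂ) (c : CliffordAlgebra (normSqForm V)) :
    Cl.α (Cl.mk z c) = Cl.mk z (CliffordAlgebra.involute c) := rfl

lemma Cl.ψ_mk (z : ℂ) (c : CliffordAlgebra (normSqForm V)) :
    Cl.ψ (Cl.mk z c) = Cl.mk (conj z) c := rfl

lemma Cl.ψ_mul (x y : Cl V) : Cl.ψ (x * y) = Cl.ψ x * Cl.ψ y := map_mul Cl.ψHom x y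

lemma Cl.ψ_star (x : Cl V) : Cl.ψ (star x) = star (Cl.ψ x) := by
  induction x using Cl.induction with
  | h0 => simp
  | h1 z c => simp [Cl.star_mk, Cl.ψ_mk]
  | h2 x y hx hy => simp only [star_add, map_add, hx, hy]

lemma Cl.ψ_α (x : Cl V) : Cl.ψ (Cl.α x) = Cl.α (Cl.ψ x) := by
  induction x using Cl.induction with
  | h0 => simp
  | h1 z c => simp [Cl.α_mk, Cl.ψ_mk]
  | h2 x y hx hy => simp only [map_add, hx, hy]

lemma Cl.ι_mul_self (v : V) : Cl.ι v * Cl.ι v = ((‖v‖ ^ 2 : ℝ) : ℂ) • (1 : Cl V) := by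
  rw [Cl.ι, Cl.mk_mul_mk, CliffordAlgebra.ι_sq_scalar, normSqForm_apply, mul_one,
    Algebra.algebraMap_eq_smul_one, Cl.one_def, Cl.smul_mk]
  have := TensorProduct.smul_tmul (R := ℝ) (‖v‖ ^ 2) (1 : ℂ) (1 : CliffordAlgebra (normSqForm V))
  refine (this.symm.trans ?_)
  rw [Complex.real_smul]
  rfl

lemma Cl.star_ι (v : V) : star (Cl.ι v) = Cl.ι v := by
  simp [Cl.ι, Cl.star_mk]

lemma Cl.α_ι (v : V) : Cl.α (Cl.ι v) = -Cl.ι v := by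
  rw [Cl.ι, Cl.α_mk, CliffordAlgebra.involute_ι]
  exact TensorProduct.tmul_neg _ _

variable {W : Type} [NormedAddCommGroup W] [InnerProductSpace ℝ W]

/-- Functoriality of the Clifford algebra in linear isometric embeddings. -/
def Cl.map (φ : V →ₗᵢ[ℝ] W) : Cl V →ₐ[ℂ] Cl W :=
  (Algebra.TensorProduct.map (AlgHom.id ℂ ℂ) (CliffordAlgebra.map
    { φ.toLinearMap with map_app' := fun v => by simp }) :
    ℂ ⊗[ℝ] CliffordAlgebra (normSqForm V) →ₐ[ℂ] ℂ ⊗[ℝ] CliffordAlgebra (normSqForm W))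

lemma Cl.map_mk (φ : V →ₗᵢ[ℝ] W) (z : ℂ) (c : CliffordAlgebra (normSqForm V)) :
    Cl.map φ (Cl.mk z c) = Cl.mk z (CliffordAlgebra.map
      { φ.toLinearMap with map_app' := fun v => by simp } c) := rfl

lemma Cl.map_ι (φ : V →ₗᵢ[ℝ] W) (v : V) : Cl.map φ (Cl.ι v) = Cl.ι (φ v) := by
  rw [Cl.ι, Cl.map_mk, CliffordAlgebra.map_apply_ι]
  rfl

lemma Cl.map_star (φ : V →ₗᵢ[ℝ] W) (x : Cl V) : Cl.map φ (star x) = star (Cl.map φ x) := by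
  induction x using Cl.induction with
  | h0 => simp
  | h1 z c =>
    simp only [Cl.star_mk, Cl.map_mk]
    congr 1
    induction c using CliffordAlgebra.induction with
    | algebraMap r => simp
    | ι v => simp
    | add a b ha hb => simp only [map_add, ha, hb]
    | mul a b ha hb => simp only [map_mul, CliffordAlgebra.reverse.map_mul, ha, hb]
  | h2 x y hx hy => simp only [star_add, map_add, hx, hy]

lemma Cl.map_α (φ : V →ₗᵢ[ℝ] W) (x : Cl V) : Cl.map φ (Cl.α x) = Cl.α (Cl.map φ x) := by
  induction x using Cl.induction with
  | h0 => simp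
  | h1 z c =>
    simp only [Cl.α_mk, Cl.map_mk]
    congr 1
    induction c using CliffordAlgebra.induction with
    | algebraMap r => simp
    | ι v => simp
    | add a b ha hb => simp only [map_add, ha, hb]
    | mul a b ha hb => simp only [map_mul, ha, hb]
  | h2 x y hx hy => simp only [map_add, hx, hy]

lemma Cl.map_ψ (φ : V →ₗᵢ[ℝ] W) (x : Cl V) : Cl.map φ (Cl.ψ x) = Cl.ψ (Cl.map φ x) := by
  induction x using Cl.induction with
  | h0 => simp
  | h1 z c => simp [Cl.ψ_mk, Cl.map_mk]
  | h2 x y hx hy => simp only [map_add, hx, hy]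

end Clifford

/-! ### Functional calculus -/

section FunctionalCalculus

variable {V : Type} [NormedAddCommGroup V] [InnerProductSpace ℝ V]

/-- The even part of `f ∈ s`, evaluated at `x`. -/
def evenPart (f : C₀(ℝ, ℂ)) (x : ℝ) : ℂ := (f x + f (-x)) / 2

/-- The odd part of `f ∈ s`, evaluated at `x`. -/
def oddPart (f : C₀(ℝ, ℂ)) (x : ℝ) : ℂ := (f x - f (-x)) / 2

/-- The functional calculus `fc v : s → Cl V`, `f ↦ f[v]`, where `f[v] = f(|v|) • 1` for even `f` and
`f[v] = f(|v|) / |v| • [v]` for odd `f` (read as `0` for `v = 0`). -/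
def fc (v : V) : CstarGr (Cl V) Cl.α := ⟨{
  toFun := fun f => evenPart f ‖v‖ • (1 : Cl V) + (oddPart f ‖v‖ / ‖v‖) • Cl.ι v
  map_smul' := fun z f => by
    simp only [evenPart, oddPart, ZeroAtInftyContinuousMap.smul_apply, smul_add, smul_smul,
      MonoidHom.id_apply, smul_eq_mul]
    congr 2 <;> ring
  map_zero' := by simp [evenPart, oddPart]
  map_add' := fun f g => by
    simp only [evenPart, oddPart, ZeroAtInftyContinuousMap.add_apply]
    module
  map_mul' := fun f g => by
    rcases eq_or_ne v 0 with rfl | hv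
    · simp [evenPart, oddPart, smul_smul, mul_comm]
    have h0 : (‖v‖ : ℂ) ≠ 0 := by simpa using hv
    simp only [evenPart, oddPart, ZeroAtInftyContinuousMap.mul_apply, mul_add, add_mul,
      smul_mul_smul_comm, one_mul, mul_one, Cl.ι_mul_self, smul_smul]
    match_scalars
    · field_simp
      ring
    · field_simp
      ring
  map_star' := fun f => by
    simp only [evenPart, oddPart, ZeroAtInftyContinuousMap.star_apply, star_add, star_smul,
      star_one, Cl.star_ι, RCLike.star_def, Complex.conj_ofReal, map_add, map_sub, map_div₀,
      map_ofNat] }, fun f => by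
  simp only [NonUnitalStarAlgHom.coe_mk', NonUnitalAlgHom.coe_mk, evenPart, oddPart,
    sGrading_apply, neg_neg, map_add, map_smul, map_one, Cl.α_ι]
  module⟩

end FunctionalCalculus

/-! ### The Hilbert space completion of the symmetric algebra -/

section MvForm

variable {n : Type} [Fintype n]

/-- The product `∏ᵢ (mᵢ)!` of factorials of the entries of a multi-index. -/
def multiFactorial (m : n →₀ ℕ) : ℕ := ∏ i, (m i).factorial

lemma multiFactorial_pos (m : n →₀ ℕ) : 0 < multiFactorial m :=
  Finset.prod_pos fun _ _ => Nat.factorial_pos _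

/-- The hermitian form on polynomials for which the monomials `x^m` are orthogonal and have squared
norm `m!`. -/
def mvForm (p q : MvPolynomial n ℂ) : ℂ :=
  ∑ m ∈ q.support, (multiFactorial m : ℂ) * (conj (p.coeff m) * q.coeff m)

lemma mvForm_eq_sum (p q : MvPolynomial n ℂ) {S : Finset (n →₀ ℕ)} (h : q.support ⊆ S) :
    mvForm p q = ∑ m ∈ S, (multiFactorial m : ℂ) * (conj (p.coeff m) * q.coeff m) :=
  Finset.sum_subset h fun m _ hm => by
    rw [MvPolynomial.notMem_support_iff.1 hm, mul_zero, mul_zero]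

lemma mvForm_conj (p q : MvPolynomial n ℂ) : conj (mvForm q p) = mvForm p q := by
  classical
  rw [mvForm_eq_sum p q (Finset.subset_union_left (s₂ := p.support)),
    mvForm_eq_sum q p (Finset.subset_union_right (s₁ := q.support)), map_sum]
  refine Finset.sum_congr rfl fun m _ => ?_
  simp only [map_mul, Complex.conj_conj, map_natCast]
  ring

lemma mvForm_add_left (p p' q : MvPolynomial n ℂ) :
    mvForm (p + p') q = mvForm p q + mvForm p' q := by
  simp only [mvForm, MvPolynomial.coeff_add, map_add, add_mul, mul_add, Finset.sum_add_distrib]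

lemma mvForm_smul_left (z : ℂ) (p q : MvPolynomial n ℂ) :
    mvForm (z • p) q = conj z * mvForm p q := by
  simp only [mvForm, MvPolynomial.coeff_smul, smul_eq_mul, map_mul, Finset.mul_sum]
  exact Finset.sum_congr rfl fun m _ => by ring

lemma mvForm_add_right (p q q' : MvPolynomial n ℂ) :
    mvForm p (q + q') = mvForm p q + mvForm p q' := by
  rw [← mvForm_conj, mvForm_add_left, map_add, mvForm_conj, mvForm_conj]

lemma mvForm_smul_right (z : ℂ) (p q : MvPolynomial n ℂ) :
    mvForm p (z • q) = z * mvForm p q := by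
  rw [← mvForm_conj, mvForm_smul_left, map_mul, mvForm_conj, Complex.conj_conj]

lemma mvForm_self (p : MvPolynomial n ℂ) :
    mvForm p p = ((∑ m ∈ p.support, (multiFactorial m : ℝ) * ‖p.coeff m‖ ^ 2 : ℝ) : ℂ) := by
  push_cast
  refine Finset.sum_congr rfl fun m _ => ?_
  rw [Complex.conj_mul']

lemma mvForm_definite (p : MvPolynomial n ℂ) (h : mvForm p p = 0) : p = 0 := by
  rw [mvForm_self] at h
  norm_cast at h
  rw [Finset.sum_eq_zero_iff_of_nonneg (fun m _ => by positivity)] at h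
  by_contra hp
  obtain ⟨m, hm⟩ := MvPolynomial.ne_zero_iff.1 hp
  have h1 := h m (MvPolynomial.mem_support_iff.2 hm)
  have h2 : (0 : ℝ) < multiFactorial m := by exact_mod_cast multiFactorial_pos m
  have h3 : 0 < ‖p.coeff m‖ := norm_pos_iff.2 hm
  have := mul_pos h2 (pow_pos h3 2)
  linarith

lemma mvForm_monomial [DecidableEq n] (a b : n →₀ ℕ) (z w : ℂ) :
    mvForm (MvPolynomial.monomial a z) (MvPolynomial.monomial b w) =
      if a = b then (multiFactorial a : ℂ) * (conj z * w) else 0 := by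
  rw [mvForm_eq_sum _ _ MvPolynomial.support_monomial_subset, Finset.sum_singleton,
    MvPolynomial.coeff_monomial, MvPolynomial.coeff_monomial, if_pos rfl]
  split_ifs with h1
  · rw [h1]
  · rw [map_zero, zero_mul, mul_zero]

lemma multiFactorial_add_single [DecidableEq n] (m : n →₀ ℕ) (i : n) :
    multiFactorial (m + Finsupp.single i 1) = multiFactorial m * (m i + 1) := by
  rw [multiFactorial, multiFactorial, ← Finset.mul_prod_erase _ _ (Finset.mem_univ i),
    ← Finset.mul_prod_erase Finset.univ (fun j => (m j).factorial) (Finset.mem_univ i)]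
  have : ∀ j ∈ Finset.univ.erase i,
      ((m + Finsupp.single i 1 : n →₀ ℕ) j).factorial = (m j).factorial := by
    intro j hj
    simp [(Finset.ne_of_mem_erase hj).symm]
  rw [Finset.prod_congr rfl this]
  simp [Nat.factorial_succ]
  ring

/-- Multiplication by a variable is adjoint to the partial derivative. -/
lemma mvForm_X_mul (i : n) (p q : MvPolynomial n ℂ) :
    mvForm (MvPolynomial.X i * p) q = mvForm p (MvPolynomial.pderiv i q) := by
  classical
  induction p using MvPolynomial.induction_on' with
  | add p p' hp hp' => rw [mul_add, mvForm_add_left, mvForm_add_left, hp, hp']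
  | monomial a z =>
    induction q using MvPolynomial.induction_on' with
    | add q q' hq hq' => rw [map_add, mvForm_add_right, mvForm_add_right, hq, hq']
    | monomial b w =>
      rw [MvPolynomial.pderiv_monomial, MvPolynomial.X, MvPolynomial.monomial_mul, mvForm_monomial,
        mvForm_monomial, one_mul, add_comm]
      by_cases h : a + Finsupp.single i 1 = b
      · subst h
        rw [if_pos rfl, add_tsub_cancel_right, if_pos rfl, multiFactorial_add_single]
        simp
        ring
      · rw [if_neg h]
        split_ifs with h2
        · rcases Nat.eq_zero_or_pos (b i) with h0 | h0
          · simp [h0]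
          · refine absurd ?_ h
            rw [h2]
            refine tsub_add_cancel_of_le ?_
            rw [Finsupp.single_le_iff]
            exact h0
        · rfl

lemma mvForm_one_left (q : MvPolynomial n ℂ) : mvForm 1 q = q.coeff 0 := by
  classical
  rw [mvForm_eq_sum 1 q (Finset.subset_insert 0 _), Finset.sum_eq_single_of_mem 0 (by simp)]
  · simp [multiFactorial]
  · intro m _ hm
    rw [MvPolynomial.coeff_one, if_neg (Ne.symm hm)]
    simp

end MvForm

section Fock

variable (V : Type) [NormedAddCommGroup V] [InnerProductSpace ℝ V]

/-- The symmetric algebra `Sym (V_ℂ)` of the complexification of `V`. -/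
def SymC : Type := SymmetricAlgebra ℂ (ℂ ⊗[ℝ] V)

instance : CommRing (SymC V) := inferInstanceAs (CommRing (SymmetricAlgebra ℂ (ℂ ⊗[ℝ] V)))
instance : Algebra ℂ (SymC V) := inferInstanceAs (Algebra ℂ (SymmetricAlgebra ℂ (ℂ ⊗[ℝ] V)))

variable {V}

/-- The inclusion of `V` into the linear summand of `Sym (V_ℂ)`. -/
def SymC.ι (x : V) : SymC V := SymmetricAlgebra.ι ℂ (ℂ ⊗[ℝ] V) ((1 : ℂ) ⊗ₜ x)

lemma SymC.induction {P : SymC V → Prop} (p : SymC V) (h1 : P 1)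
    (hadd : ∀ p q, P p → P q → P (p + q)) (hsmul : ∀ (z : ℂ) p, P p → P (z • p))
    (hι : ∀ x p, P p → P (SymC.ι x * p)) : P p := by
  have key : ∀ q, P q → P (p * q) := by
    refine SymmetricAlgebra.induction (R := ℂ) (M := ℂ ⊗[ℝ] V)
      (motive := fun p => ∀ q : SymC V, P q → P ((show SymC V from p) * q)) ?_ ?_ ?_ ?_ p
    · intro z q hq
      exact (Algebra.smul_def z q) ▸ hsmul z q hq
    · intro w q hq
      induction w using TensorProduct.induction_on with
      | zero =>
        have := hsmul 0 q hq
        rw [map_zero]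
        rw [zero_smul, ← zero_mul q] at this
        exact this
      | tmul z x =>
        have h2 := hsmul z _ (hι x q hq)
        have h3 : (show SymC V from SymmetricAlgebra.ι ℂ (ℂ ⊗[ℝ] V) (z ⊗ₜ[ℝ] x)) =
            z • SymC.ι x := by
          rw [SymC.ι]
          refine Eq.trans ?_ (map_smul (SymmetricAlgebra.ι ℂ (ℂ ⊗[ℝ] V)) z _)
          rw [TensorProduct.smul_tmul', smul_eq_mul, mul_one]
        rw [h3, smul_mul_assoc]
        exact h2
      | add a b ha hb =>
        have := hadd _ _ ha hb
        rw [← add_mul] at this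
        rw [map_add]
        exact this
    · intro a b ha hb q hq
      have := ha _ (hb q hq)
      rw [← mul_assoc] at this
      exact this
    · intro a b ha hb q hq
      have := hadd _ _ (ha q hq) (hb q hq)
      rw [← add_mul] at this
      exact this
  simpa using key 1 h1

variable (V) [FiniteDimensional ℝ V]

/-- The identification of `Sym (V_ℂ)` with the polynomial algebra on an orthonormal basis of `V`. -/
def SymC.coords : SymC V ≃ₐ[ℂ] MvPolynomial (Fin (Module.finrank ℝ V)) ℂ :=
  SymmetricAlgebra.equivMvPolynomial
    (Algebra.TensorProduct.basis ℂ (stdOrthonormalBasis ℝ V).toBasis)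

variable {V}

/-- The hermitian form on `Sym (V_ℂ)` for which the monomials `e^m` in an orthonormal basis of `V` are
orthogonal of squared norm `m!`. It is independent of the basis:
`⟨v₁⋯vₖ, w₁⋯wₖ⟩ = ∑ (π ∈ Σₖ), ∏ᵢ ⟨vᵢ, w_π(i)⟩`. -/
def SymC.form (p q : SymC V) : ℂ := mvForm (SymC.coords V p) (SymC.coords V q)

lemma SymC.coords_ι (x : V) : SymC.coords V (SymC.ι x) =
    ∑ i, ((⟪stdOrthonormalBasis ℝ V i, x⟫_ℝ : ℝ) : ℂ) • MvPolynomial.X i := by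
  have hx : (1 : ℂ) ⊗ₜ[ℝ] x = ∑ i, ((⟪stdOrthonormalBasis ℝ V i, x⟫_ℝ : ℝ) : ℂ) •
      Algebra.TensorProduct.basis ℂ (stdOrthonormalBasis ℝ V).toBasis i := by
    conv_lhs => rw [← (stdOrthonormalBasis ℝ V).sum_repr' x, TensorProduct.tmul_sum]
    refine Finset.sum_congr rfl fun i _ => ?_
    rw [Algebra.TensorProduct.basis_apply, TensorProduct.smul_tmul', ← TensorProduct.smul_tmul]
    simp
  have h2 : SymC.ι x = (show SymC V from SymmetricAlgebra.ι ℂ (ℂ ⊗[ℝ] V)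
    (∑ i, ((⟪stdOrthonormalBasis ℝ V i, x⟫_ℝ : ℝ) : ℂ) •
      Algebra.TensorProduct.basis ℂ (stdOrthonormalBasis ℝ V).toBasis i)) := by
    rw [← hx]; rfl
  rw [h2, map_sum]
  simp only [map_smul]
  refine (map_sum (SymC.coords V) _ _).trans ?_
  refine Finset.sum_congr rfl fun i _ => ?_
  refine (map_smul (SymC.coords V) _ _).trans ?_
  congr 1
  exact SymmetricAlgebra.equivMvPolynomial_ι_apply _ _

/-- The derivation of `Sym (V_ℂ)` with `y ↦ ⟨x, y⟩` for `y ∈ V`. -/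
def SymC.ann (x : V) : SymC V →ₗ[ℂ] SymC V :=
  (SymC.coords V).symm.toLinearMap ∘ₗ (MvPolynomial.mkDerivation ℂ
    (fun i => MvPolynomial.C ((⟪stdOrthonormalBasis ℝ V i, x⟫_ℝ : ℝ) : ℂ))).toLinearMap ∘ₗ
    (SymC.coords V).toLinearMap

lemma SymC.coords_ann (x : V) (p : SymC V) : SymC.coords V (SymC.ann x p) =
    MvPolynomial.mkDerivation ℂ
    (fun i => MvPolynomial.C ((⟪stdOrthonormalBasis ℝ V i, x⟫_ℝ : ℝ) : ℂ)) (SymC.coords V p) := by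
  simp [SymC.ann]

lemma SymC.ann_mul (x : V) (p q : SymC V) :
    SymC.ann x (p * q) = p * SymC.ann x q + SymC.ann x p * q := by
  apply (SymC.coords V).injective
  simp only [SymC.coords_ann, map_mul, map_add, Derivation.leibniz, smul_eq_mul]
  ring

lemma SymC.ann_one (x : V) : SymC.ann x 1 = 0 := by
  apply (SymC.coords V).injective
  simp [SymC.coords_ann]

lemma SymC.ann_ι (x y : V) : SymC.ann x (SymC.ι y) = ((⟪x, y⟫_ℝ : ℝ) : ℂ) • (1 : SymC V) := by
  apply (SymC.coords V).injective
  rw [SymC.coords_ann, SymC.coords_ι, map_sum, map_smul, map_one]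
  simp only [Derivation.map_smul, MvPolynomial.mkDerivation_X]
  rw [← (stdOrthonormalBasis ℝ V).sum_inner_mul_inner x y]
  simp only [MvPolynomial.C_eq_smul_one, smul_smul, ← Finset.sum_smul]
  congr 1
  push_cast
  refine Finset.sum_congr rfl fun i _ => ?_
  rw [real_inner_comm x, mul_comm]

lemma SymC.form_add_left (p p' q : SymC V) :
    SymC.form (p + p') q = SymC.form p q + SymC.form p' q := by
  simp [SymC.form, mvForm_add_left]

lemma SymC.form_smul_left (z : ℂ) (p q : SymC V) :
    SymC.form (z • p) q = conj z * SymC.form p q := by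
  simp [SymC.form, mvForm_smul_left]

lemma SymC.form_add_right (p q q' : SymC V) :
    SymC.form p (q + q') = SymC.form p q + SymC.form p q' := by
  simp [SymC.form, mvForm_add_right]

lemma SymC.form_smul_right (z : ℂ) (p q : SymC V) :
    SymC.form p (z • q) = z * SymC.form p q := by
  simp [SymC.form, mvForm_smul_right]

/-- Multiplication by `x ∈ V` is adjoint to the derivation `∂ₓ`. -/
lemma SymC.form_ι_mul (x : V) (p q : SymC V) :
    SymC.form (SymC.ι x * p) q = SymC.form p (SymC.ann x q) := by
  rw [SymC.form, SymC.form, SymC.coords_ann, map_mul, SymC.coords_ι]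
  have hD : ∀ r : MvPolynomial (Fin (Module.finrank ℝ V)) ℂ, MvPolynomial.mkDerivation ℂ
      (fun i => MvPolynomial.C ((⟪stdOrthonormalBasis ℝ V i, x⟫_ℝ : ℝ) : ℂ)) r =
      ∑ i, ((⟪stdOrthonormalBasis ℝ V i, x⟫_ℝ : ℝ) : ℂ) • MvPolynomial.pderiv i r := by
    intro r
    have hc : ∀ (f : Fin (Module.finrank ℝ V) → Derivation ℂ
        (MvPolynomial (Fin (Module.finrank ℝ V)) ℂ) (MvPolynomial (Fin (Module.finrank ℝ V)) ℂ)) p,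
        (∑ i, f i) p = ∑ i, f i p := fun f p => by
      rw [← Derivation.coeFnAddMonoidHom_apply, map_sum, Finset.sum_apply]
      rfl
    have h : MvPolynomial.mkDerivation ℂ
        (fun i => MvPolynomial.C ((⟪stdOrthonormalBasis ℝ V i, x⟫_ℝ : ℝ) : ℂ)) =
        ∑ i, ((⟪stdOrthonormalBasis ℝ V i, x⟫_ℝ : ℝ) : ℂ) •
          MvPolynomial.pderiv (R := ℂ) (σ := Fin (Module.finrank ℝ V)) i := by
      classical
      refine MvPolynomial.derivation_ext fun j => ?_
      rw [MvPolynomial.mkDerivation_X, hc]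
      simp only [Derivation.smul_apply, MvPolynomial.pderiv_X]
      rw [Finset.sum_eq_single j]
      · simp [MvPolynomial.C_eq_smul_one]
      · intro i _ hij
        simp [hij]
      · simp
    rw [h, hc]
    rfl
  have hl : ∀ (s : Finset (Fin (Module.finrank ℝ V)))
      (f : Fin (Module.finrank ℝ V) → MvPolynomial (Fin (Module.finrank ℝ V)) ℂ) r,
      mvForm (∑ i ∈ s, f i) r = ∑ i ∈ s, mvForm (f i) r := by
    intro s f r
    classical
    induction s using Finset.induction_on with
    | empty => simp [mvForm]
    | insert a s ha ih => rw [Finset.sum_insert ha, Finset.sum_insert ha, mvForm_add_left, ih]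
  have hr : ∀ (s : Finset (Fin (Module.finrank ℝ V)))
      (f : Fin (Module.finrank ℝ V) → MvPolynomial (Fin (Module.finrank ℝ V)) ℂ) r,
      mvForm r (∑ i ∈ s, f i) = ∑ i ∈ s, mvForm r (f i) := by
    intro s f r
    rw [← mvForm_conj, hl, map_sum]
    simp only [mvForm_conj]
  rw [hD, Finset.sum_mul, hl, hr]
  refine Finset.sum_congr rfl fun i _ => ?_
  rw [smul_mul_assoc, mvForm_smul_left, mvForm_smul_right, mvForm_X_mul, Complex.conj_ofReal]

lemma SymC.form_conj (p q : SymC V) : conj (SymC.form q p) = SymC.form p q := mvForm_conj _ _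

lemma SymC.form_zero_left (q : SymC V) : SymC.form 0 q = 0 := by
  simpa using SymC.form_smul_left 0 0 q

lemma SymC.form_zero_right (q : SymC V) : SymC.form q 0 = 0 := by
  simpa using SymC.form_smul_right 0 q 0

lemma SymC.form_one_one : SymC.form (1 : SymC V) 1 = 1 := by
  rw [SymC.form, map_one, mvForm_one_left]
  simp

lemma SymC.form_one_ι_mul (x : V) (p : SymC V) : SymC.form 1 (SymC.ι x * p) = 0 := by
  rw [← SymC.form_conj, SymC.form_ι_mul, SymC.ann_one, SymC.form_zero_right, map_zero]

/-- The inner product on `Sym (V_ℂ)`. -/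
abbrev SymC.core : InnerProductSpace.Core ℂ (SymC V) where
  inner := SymC.form
  conj_inner_symm p q := SymC.form_conj p q
  re_inner_nonneg p := by
    change 0 ≤ RCLike.re (mvForm _ _)
    rw [mvForm_self]
    simp only [RCLike.re_eq_complex_re, Complex.ofReal_re]
    positivity
  add_left := SymC.form_add_left
  smul_left p q z := SymC.form_smul_left z p q
  definite p h := by
    have := mvForm_definite _ h
    simpa using this

instance : NormedAddCommGroup (SymC V) := SymC.core.toNormedAddCommGroup

instance : InnerProductSpace ℂ (SymC V) := InnerProductSpace.ofCore SymC.core.toCore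

lemma SymC.inner_eq (p q : SymC V) : ⟪p, q⟫_ℂ = SymC.form p q := rfl

/-- The conjugate-linear multiplicative involution of `Sym (V_ℂ)` that fixes `V`. -/
def SymC.ψHom : SymC V →+* SymC V :=
  (SymC.coords V).symm.toRingEquiv.toRingHom.comp
    ((MvPolynomial.map (starRingEnd ℂ)).comp (SymC.coords V).toRingEquiv.toRingHom)

lemma SymC.coords_ψHom (p : SymC V) :
    SymC.coords V (SymC.ψHom p) = MvPolynomial.map (starRingEnd ℂ) (SymC.coords V p) := by
  simp [SymC.ψHom]

/-- `SymC.ψHom` as a conjugate-linear map. -/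
def SymC.ψ : SymC V →ₛₗ[starRingEnd ℂ] SymC V where
  toFun := SymC.ψHom
  map_add' := map_add _
  map_smul' z p := by
    apply (SymC.coords V).injective
    rw [SymC.coords_ψHom, map_smul (SymC.coords V), map_smul (SymC.coords V), SymC.coords_ψHom,
      MvPolynomial.smul_eq_C_mul, map_mul, MvPolynomial.map_C, MvPolynomial.smul_eq_C_mul]

lemma SymC.ψ_one : SymC.ψ (1 : SymC V) = 1 := map_one SymC.ψHom

lemma SymC.ψ_ι (x : V) : SymC.ψ (SymC.ι x) = SymC.ι x := by
  apply (SymC.coords V).injective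
  refine (SymC.coords_ψHom _).trans ?_
  rw [SymC.coords_ι, map_sum]
  simp [MvPolynomial.smul_eq_C_mul]

lemma SymC.ψ_ψ (p : SymC V) : SymC.ψ (SymC.ψ p) = p := by
  apply (SymC.coords V).injective
  refine (SymC.coords_ψHom _).trans ?_
  rw [show SymC.coords V (SymC.ψ p) = _ from SymC.coords_ψHom p, MvPolynomial.map_map]
  simp [MvPolynomial.map_id]

lemma SymC.form_ψ (p q : SymC V) : SymC.form (SymC.ψ p) (SymC.ψ q) = conj (SymC.form p q) := by
  rw [SymC.form, SymC.form, show SymC.coords V (SymC.ψ p) = _ from SymC.coords_ψHom p,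
    show SymC.coords V (SymC.ψ q) = _ from SymC.coords_ψHom q,
    mvForm_eq_sum _ _ (MvPolynomial.support_map_subset _ _), mvForm, map_sum]
  refine Finset.sum_congr rfl fun m _ => ?_
  simp [MvPolynomial.coeff_map]

lemma SymC.norm_ψ (p : SymC V) : ‖SymC.ψ p‖ = ‖p‖ := by
  rw [@norm_eq_sqrt_re_inner ℂ, @norm_eq_sqrt_re_inner ℂ _ _ _ _ p, SymC.inner_eq, SymC.inner_eq,
    SymC.form_ψ, RCLike.conj_re]

variable {W : Type} [NormedAddCommGroup W] [InnerProductSpace ℝ W] [FiniteDimensional ℝ W]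

/-- Functoriality of `Sym (V_ℂ)` in linear isometric embeddings. -/
def SymC.map (φ : V →ₗᵢ[ℝ] W) : SymC V →ₐ[ℂ] SymC W :=
  (SymmetricAlgebra.lift ((SymmetricAlgebra.ι ℂ (ℂ ⊗[ℝ] W)).comp
    (φ.toLinearMap.baseChange ℂ)) :
    SymmetricAlgebra ℂ (ℂ ⊗[ℝ] V) →ₐ[ℂ] SymmetricAlgebra ℂ (ℂ ⊗[ℝ] W))

lemma SymC.map_ι (φ : V →ₗᵢ[ℝ] W) (x : V) : SymC.map φ (SymC.ι x) = SymC.ι (φ x) := by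
  have h := SymmetricAlgebra.lift_ι_apply (A := SymmetricAlgebra ℂ (ℂ ⊗[ℝ] W))
    ((SymmetricAlgebra.ι ℂ (ℂ ⊗[ℝ] W)).comp (φ.toLinearMap.baseChange ℂ)) ((1 : ℂ) ⊗ₜ[ℝ] x)
  exact h

lemma SymC.ann_map (φ : V →ₗᵢ[ℝ] W) (x : V) (p : SymC V) :
    SymC.ann (φ x) (SymC.map φ p) = SymC.map φ (SymC.ann x p) := by
  induction p using SymC.induction with
  | h1 => simp [SymC.ann_one]
  | hadd p q hp hq => simp only [map_add, hp, hq]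
  | hsmul z p hp => simp only [map_smul, hp]
  | hι y p hp =>
    simp only [map_mul, SymC.ann_mul, map_add, hp, SymC.map_ι, SymC.ann_ι,
      LinearIsometry.inner_map_map, map_smul, map_one]

/-- If `y` is orthogonal to the image of `φ`, then `∂_y` vanishes on the image of `Sym φ`. -/
lemma SymC.ann_map_of_orthogonal (φ : V →ₗᵢ[ℝ] W) (y : W) (h : ∀ x, ⟪y, φ x⟫_ℝ = 0) (p : SymC V) :
    SymC.ann y (SymC.map φ p) = 0 := by
  induction p using SymC.induction with
  | h1 => simp [SymC.ann_one]
  | hadd p q hp hq => simp only [map_add, hp, hq, add_zero]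
  | hsmul z p hp => simp only [map_smul, hp, smul_zero]
  | hι x p hp => simp [map_mul, SymC.ann_mul, hp, SymC.map_ι, SymC.ann_ι, h]

variable {X : Type} [NormedAddCommGroup X] [InnerProductSpace ℝ X] [FiniteDimensional ℝ X]

/-- For isometric embeddings with orthogonal images, the multiplication map
`Sym (V_ℂ) ⊗ Sym (W_ℂ) → Sym (X_ℂ)` is isometric. -/
lemma SymC.form_mul_mul (φ : V →ₗᵢ[ℝ] X) (χ : W →ₗᵢ[ℝ] X) (h : ∀ x y, ⟪φ x, χ y⟫_ℝ = 0)
    (p p' : SymC V) (q q' : SymC W) :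
    SymC.form (SymC.map φ p * SymC.map χ q) (SymC.map φ p' * SymC.map χ q') =
      SymC.form p p' * SymC.form q q' := by
  have hone : ∀ (p' : SymC V) (q' : SymC W),
      SymC.form 1 (SymC.map φ p' * SymC.map χ q') = SymC.form 1 p' * SymC.form 1 q' := by
    intro p' q'
    induction p' using SymC.induction with
    | h1 =>
      rw [map_one, one_mul, SymC.form_one_one, one_mul]
      induction q' using SymC.induction with
      | h1 => rw [map_one, SymC.form_one_one, SymC.form_one_one]
      | hadd p q hp hq => rw [map_add, SymC.form_add_right, SymC.form_add_right, hp, hq]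
      | hsmul z p hp => rw [map_smul, SymC.form_smul_right, SymC.form_smul_right, hp]
      | hι y p hp => rw [map_mul, SymC.map_ι, SymC.form_one_ι_mul, SymC.form_one_ι_mul]
    | hadd p q hp hq =>
      rw [map_add, add_mul, SymC.form_add_right, SymC.form_add_right, hp, hq, add_mul]
    | hsmul z p hp =>
      rw [map_smul, smul_mul_assoc, SymC.form_smul_right, SymC.form_smul_right, hp, mul_assoc]
    | hι y p hp =>
      rw [map_mul, SymC.map_ι, mul_assoc, SymC.form_one_ι_mul, SymC.form_one_ι_mul, zero_mul]
  induction p using SymC.induction generalizing p' with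
  | h1 =>
    rw [map_one, one_mul]
    induction q using SymC.induction generalizing q' with
    | h1 => rw [map_one, hone]
    | hadd p q hp hq => rw [map_add, SymC.form_add_left, SymC.form_add_left, hp, hq, mul_add]
    | hsmul z p hp => rw [map_smul, SymC.form_smul_left, SymC.form_smul_left, hp]; ring
    | hι y p hp =>
      rw [map_mul, SymC.map_ι, SymC.form_ι_mul, SymC.form_ι_mul, SymC.ann_mul,
        SymC.ann_map_of_orthogonal φ (χ y) (fun x => by rw [real_inner_comm]; exact h x y),
        zero_mul, add_zero, SymC.ann_map, hp]
  | hadd p q hp hq =>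
    rw [map_add, add_mul, SymC.form_add_left, SymC.form_add_left, hp, hq, add_mul]
  | hsmul z p hp =>
    rw [map_smul, smul_mul_assoc, SymC.form_smul_left, SymC.form_smul_left, hp, mul_assoc]
  | hι x p hp =>
    rw [map_mul, SymC.map_ι, mul_assoc, SymC.form_ι_mul, SymC.form_ι_mul, SymC.ann_mul,
      SymC.ann_map_of_orthogonal χ (φ x) (h x), mul_zero, zero_add, SymC.ann_map, hp]

lemma SymC.form_map (φ : V →ₗᵢ[ℝ] W) (p q : SymC V) :
    SymC.form (SymC.map φ p) (SymC.map φ q) = SymC.form p q := by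
  induction p using SymC.induction generalizing q with
  | h1 =>
    rw [map_one]
    induction q using SymC.induction with
    | h1 => rw [map_one, SymC.form_one_one, SymC.form_one_one]
    | hadd p q hp hq => rw [map_add, SymC.form_add_right, SymC.form_add_right, hp, hq]
    | hsmul z p hp => rw [map_smul, SymC.form_smul_right, SymC.form_smul_right, hp]
    | hι y p hp => rw [map_mul, SymC.map_ι, SymC.form_one_ι_mul, SymC.form_one_ι_mul]
  | hadd p q hp hq => rw [map_add, SymC.form_add_left, SymC.form_add_left, hp, hq]
  | hsmul z p hp => rw [map_smul, SymC.form_smul_left, SymC.form_smul_left, hp]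
  | hι y p hp => rw [map_mul, SymC.map_ι, SymC.form_ι_mul, SymC.form_ι_mul, SymC.ann_map, hp]

lemma SymC.norm_map (φ : V →ₗᵢ[ℝ] W) (p : SymC V) : ‖SymC.map φ p‖ = ‖p‖ := by
  rw [@norm_eq_sqrt_re_inner ℂ, @norm_eq_sqrt_re_inner ℂ _ _ _ _ p, SymC.inner_eq, SymC.inner_eq,
    SymC.form_map]

lemma SymC.map_ψ (φ : V →ₗᵢ[ℝ] W) (p : SymC V) :
    SymC.map φ (SymC.ψ p) = SymC.ψ (SymC.map φ p) := by
  have hm : ∀ {U : Type} [NormedAddCommGroup U] [InnerProductSpace ℝ U] [FiniteDimensional ℝ U]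
    (a b : SymC U), SymC.ψ (a * b) = SymC.ψ a * SymC.ψ b := fun a b => map_mul SymC.ψHom a b
  induction p using SymC.induction with
  | h1 => rw [SymC.ψ_one, map_one, SymC.ψ_one]
  | hadd p q hp hq => simp only [map_add, hp, hq]
  | hsmul z p hp => simp only [map_smul, map_smulₛₗ, hp]
  | hι x p hp => simp only [map_mul, hm, SymC.ψ_ι, SymC.map_ι, hp]

end Fock

/-! ### Compact operators and their tensor products -/

section Compact

variable (H : Type*) [NormedAddCommGroup H] [InnerProductSpace ℂ H] [CompleteSpace H]

lemma isCompactOperator_rankOne {H : Type*} [NormedAddCommGroup H] [InnerProductSpace ℂ H]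
    (x y : H) : IsCompactOperator (InnerProductSpace.rankOne ℂ x y) := by
  rw [InnerProductSpace.rankOne_def']
  have h : IsCompactOperator (innerSL ℂ y : H →L[ℂ] ℂ) :=
    isCompactOperator_of_locallyCompactSpace_dom (innerSL ℂ y : H →L[ℂ] ℂ)
  exact h.clm_comp (ContinuousLinearMap.toSpanSingleton ℂ x)

/-- Every compact operator is a norm limit of finite rank operators. -/
lemma compact_mem_closure {H : Type*} [NormedAddCommGroup H] [InnerProductSpace ℂ H]
    [CompleteSpace H] {T : H →L[ℂ] H} (hT : IsCompactOperator T) :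
    T ∈ (Submodule.span ℂ (Set.range fun xy : H × H =>
      InnerProductSpace.rankOne ℂ xy.1 xy.2)).topologicalClosure := by
  rw [← SetLike.mem_coe, Submodule.topologicalClosure_coe, Metric.mem_closure_iff]
  intro ε hε
  have htb : TotallyBounded (T '' Metric.closedBall 0 1) :=
    (hT.isCompact_closure_image_closedBall 1).totallyBounded.subset subset_closure
  obtain ⟨t, htf, ht⟩ := Metric.totallyBounded_iff.1 htb (ε / 2) (by positivity)
  set U := Submodule.span ℂ t
  have : FiniteDimensional ℂ U := FiniteDimensional.span_of_finite ℂ htf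
  refine ⟨U.starProjection ∘L T, ?_, ?_⟩
  · rw [(stdOrthonormalBasis ℂ U).starProjection_eq_sum_rankOne, ContinuousLinearMap.finsetSum_comp]
    refine Submodule.sum_mem _ fun i _ => ?_
    rw [InnerProductSpace.rankOne_comp]
    exact Submodule.subset_span ⟨(_, _), rfl⟩
  · rw [dist_eq_norm]
    refine lt_of_le_of_lt (ContinuousLinearMap.opNorm_le_of_unit_norm (C := ε / 2)
      (by positivity) fun x hx => ?_) (by linarith)
    have hx' : T x ∈ T '' Metric.closedBall 0 1 := ⟨x, by simp [hx], rfl⟩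
    obtain ⟨y, hy, hxy⟩ := Set.mem_iUnion₂.1 (ht hx')
    have hyU : y ∈ U := Submodule.subset_span hy
    rw [Metric.mem_ball, dist_eq_norm] at hxy
    have h1 := U.starProjection_minimal (T x)
    have h2 : ‖T x - U.starProjection (T x)‖ ≤ ‖T x - y‖ := by
      rw [h1]
      exact ciInf_le ⟨0, by rintro _ ⟨z, rfl⟩; positivity⟩ (⟨y, hyU⟩ : U)
    exact (h2.trans hxy.le)

/-- A closed subspace of operators that contains all operators of rank one contains all compact
operators. -/
lemma compact_mem_of_rankOne {H : Type*} [NormedAddCommGroup H] [InnerProductSpace ℂ H]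
    [CompleteSpace H] {T : H →L[ℂ] H} (hT : IsCompactOperator T) (S : Submodule ℂ (H →L[ℂ] H))
    (hS : IsClosed (S : Set (H →L[ℂ] H))) (h : ∀ x y, InnerProductSpace.rankOne ℂ x y ∈ S) :
    T ∈ S := by
  refine Submodule.topologicalClosure_minimal _ (Submodule.span_le.2 ?_) hS (compact_mem_closure hT)
  rintro _ ⟨xy, rfl⟩
  exact h _ _

lemma isCompactOperator_adjoint {H : Type*} [NormedAddCommGroup H] [InnerProductSpace ℂ H]
    [CompleteSpace H] {T : H →L[ℂ] H} (hT : IsCompactOperator T) :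
    IsCompactOperator (ContinuousLinearMap.adjoint T) := by
  let S : Submodule ℂ (H →L[ℂ] H) :=
    { carrier := {T | IsCompactOperator (ContinuousLinearMap.adjoint T)}
      add_mem' := fun {a b} ha hb => by
        simp only [Set.mem_ofPred_eq, map_add] at *
        exact ha.add hb
      zero_mem' := by
        simp only [Set.mem_ofPred_eq, map_zero]
        exact isCompactOperator_zero
      smul_mem' := fun c a ha => by
        simp only [Set.mem_ofPred_eq, map_smulₛₗ] at *
        exact ha.smul _ }
  refine compact_mem_of_rankOne hT S ?_ fun x y => ?_
  · have hc : IsClosed {f : H →L[ℂ] H | IsCompactOperator f} := isClosed_setOfPred_isCompactOperator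
    exact hc.preimage (ContinuousLinearMap.adjoint (𝕜 := ℂ) (E := H) (F := H)).continuous
  · change IsCompactOperator _
    rw [InnerProductSpace.adjoint_rankOne]
    exact isCompactOperator_rankOne y x

/-- The *-algebra of compact operators on a Hilbert space. -/
def compactAlg : NonUnitalStarSubalgebra ℂ (H →L[ℂ] H) where
  carrier := {T | IsCompactOperator T}
  add_mem' ha hb := IsCompactOperator.add ha hb
  zero_mem' := isCompactOperator_zero
  mul_mem' {_ b} ha _ := IsCompactOperator.comp_clm ha b
  smul_mem' c _ ha := IsCompactOperator.smul ha c
  star_mem' ha := isCompactOperator_adjoint ha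

/-- The type of compact operators on a Hilbert space. -/
def Compacts : Type _ := compactAlg H

instance Compacts.instRing : NonUnitalNormedRing (Compacts H) := inferInstanceAs (NonUnitalNormedRing (compactAlg H))
instance Compacts.instModule : NormedSpace ℂ (Compacts H) := inferInstanceAs (NormedSpace ℂ (compactAlg H))
instance : IsScalarTower ℂ (Compacts H) (Compacts H) :=
  inferInstanceAs (IsScalarTower ℂ (compactAlg H) (compactAlg H))
instance : SMulCommClass ℂ (Compacts H) (Compacts H) :=
  inferInstanceAs (SMulCommClass ℂ (compactAlg H) (compactAlg H))
instance : StarRing (Compacts H) := inferInstanceAs (StarRing (compactAlg H))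
instance : StarModule ℂ (Compacts H) := inferInstanceAs (StarModule ℂ (compactAlg H))

end Compact

section TensorOp

variable {H₁ H₂ H : Type*} [NormedAddCommGroup H₁] [InnerProductSpace ℂ H₁] [CompleteSpace H₁]
  [NormedAddCommGroup H₂] [InnerProductSpace ℂ H₂] [CompleteSpace H₂]
  [NormedAddCommGroup H] [InnerProductSpace ℂ H] [CompleteSpace H]

lemma norm_map_le (k : H₁ →L[ℂ] H₁) (k' : H₂ →L[ℂ] H₂) (t : H₁ ⊗[ℂ] H₂) :
    ‖TensorProduct.map k.toLinearMap k'.toLinearMap t‖ ≤ 4 * ‖k‖ * ‖k'‖ * ‖t‖ := by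
  obtain ⟨u, c, hk, hc⟩ := CStarAlgebra.exists_sum_four_unitary k
  obtain ⟨w, d, hk', hd⟩ := CStarAlgebra.exists_sum_four_unitary k'
  have hu : ∀ i j, ‖TensorProduct.map (u i : H₁ →L[ℂ] H₁).toLinearMap
      (w j : H₂ →L[ℂ] H₂).toLinearMap t‖ = ‖t‖ := fun i j =>
    TensorProduct.norm_map
      ⟨(u i : H₁ →L[ℂ] H₁).toLinearMap, fun x => ContinuousLinearMap.norm_map_of_mem_unitary
        (u i).2 x⟩
      ⟨(w j : H₂ →L[ℂ] H₂).toLinearMap, fun x => ContinuousLinearMap.norm_map_of_mem_unitary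
        (w j).2 x⟩ t
  have e : TensorProduct.map k.toLinearMap k'.toLinearMap t =
      ∑ i, ∑ j, (c i * d j) • TensorProduct.map (u i : H₁ →L[ℂ] H₁).toLinearMap
        (w j : H₂ →L[ℂ] H₂).toLinearMap t := by
    conv_lhs => rw [hk, hk']
    clear hu
    induction t using TensorProduct.induction_on with
    | zero => simp
    | tmul x y =>
      simp only [TensorProduct.map_tmul, ContinuousLinearMap.coe_coe,
        sum_apply, smul_apply, TensorProduct.sum_tmul,
        TensorProduct.tmul_sum, TensorProduct.smul_tmul_smul]
      exact Finset.sum_comm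
    | add a b ha hb =>
      simp only [map_add, ha, hb, smul_add, Finset.sum_add_distrib]
  rw [e]
  calc _ ≤ ∑ i : Fin 4, ∑ j : Fin 4, ‖k‖ / 2 * (‖k'‖ / 2) * ‖t‖ := by
        refine norm_sum_le_of_le _ fun i _ => norm_sum_le_of_le _ fun j _ => ?_
        rw [norm_smul, hu, norm_mul]
        gcongr
        exacts [hc i, hd j]
    _ = _ := by simp; ring

variable (J : H₁ ⊗[ℂ] H₂ →ₗᵢ[ℂ] H)

/-- For a dense isometric embedding `J` of the algebraic tensor product `H₁ ⊗ H₂` into `H`, the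
bounded operator `k ⊗ k'` on the completed tensor product `H`. -/
def tensorOp (k : H₁ →L[ℂ] H₁) (k' : H₂ →L[ℂ] H₂) : H →L[ℂ] H :=
  (J.toLinearMap ∘ₗ TensorProduct.map k.toLinearMap k'.toLinearMap).extendOfNorm J.toLinearMap

variable {J}

lemma tensorOp_apply (hJ : DenseRange J) (k : H₁ →L[ℂ] H₁) (k' : H₂ →L[ℂ] H₂) (t : H₁ ⊗[ℂ] H₂) :
    tensorOp J k k' (J t) = J (TensorProduct.map k.toLinearMap k'.toLinearMap t) :=
  LinearMap.extendOfNorm_eq (e := J.toLinearMap) hJ ⟨4 * ‖k‖ * ‖k'‖, fun x => by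
    simpa using norm_map_le k k' x⟩ t

lemma tensorOp_unique (hJ : DenseRange J) {k : H₁ →L[ℂ] H₁} {k' : H₂ →L[ℂ] H₂} {T : H →L[ℂ] H}
    (h : ∀ x y, T (J (x ⊗ₜ y)) = J (k x ⊗ₜ k' y)) : T = tensorOp J k k' := by
  refine ContinuousLinearMap.coeFn_injective (hJ.equalizer T.continuous
    (tensorOp J k k').continuous (funext fun t => ?_))
  simp only [Function.comp_apply, tensorOp_apply hJ]
  induction t using TensorProduct.induction_on with
  | zero => simp
  | tmul x y => simp [h]
  | add a b ha hb => simp only [map_add, ha, hb]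

lemma norm_tensorOp_le (hJ : DenseRange J) (k : H₁ →L[ℂ] H₁) (k' : H₂ →L[ℂ] H₂) :
    ‖tensorOp J k k'‖ ≤ 4 * ‖k‖ * ‖k'‖ :=
  LinearMap.opNorm_extendOfNorm_le (e := J.toLinearMap) hJ (by positivity) fun x => by
    simpa using norm_map_le k k' x

lemma tensorOp_add_left (hJ : DenseRange J) (k l : H₁ →L[ℂ] H₁) (k' : H₂ →L[ℂ] H₂) :
    tensorOp J (k + l) k' = tensorOp J k k' + tensorOp J l k' :=
  (tensorOp_unique hJ fun x y => by simp [tensorOp_apply hJ, TensorProduct.add_tmul]).symm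

lemma tensorOp_add_right (hJ : DenseRange J) (k : H₁ →L[ℂ] H₁) (k' l' : H₂ →L[ℂ] H₂) :
    tensorOp J k (k' + l') = tensorOp J k k' + tensorOp J k l' :=
  (tensorOp_unique hJ fun x y => by simp [tensorOp_apply hJ, TensorProduct.tmul_add]).symm

lemma tensorOp_smul_left (hJ : DenseRange J) (z : ℂ) (k : H₁ →L[ℂ] H₁) (k' : H₂ →L[ℂ] H₂) :
    tensorOp J (z • k) k' = z • tensorOp J k k' :=
  (tensorOp_unique hJ fun x y => by
    simp [tensorOp_apply hJ, ← TensorProduct.smul_tmul']).symm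

lemma tensorOp_smul_right (hJ : DenseRange J) (z : ℂ) (k : H₁ →L[ℂ] H₁) (k' : H₂ →L[ℂ] H₂) :
    tensorOp J k (z • k') = z • tensorOp J k k' :=
  (tensorOp_unique hJ fun x y => by simp [tensorOp_apply hJ]).symm

lemma tensorOp_rankOne (hJ : DenseRange J) (x y : H₁) (x' y' : H₂) :
    tensorOp J (InnerProductSpace.rankOne ℂ x y) (InnerProductSpace.rankOne ℂ x' y') =
      InnerProductSpace.rankOne ℂ (J (x ⊗ₜ x')) (J (y ⊗ₜ y')) :=
  (tensorOp_unique hJ fun a b => by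
    simp [← TensorProduct.smul_tmul', smul_smul, mul_comm]).symm

lemma isCompactOperator_tensorOp (hJ : DenseRange J) {k : H₁ →L[ℂ] H₁} {k' : H₂ →L[ℂ] H₂}
    (hk : IsCompactOperator k) (hk' : IsCompactOperator k') :
    IsCompactOperator (tensorOp J k k') := by
  let B : (H₁ →L[ℂ] H₁) →L[ℂ] (H₂ →L[ℂ] H₂) →L[ℂ] (H →L[ℂ] H) :=
    LinearMap.mkContinuous₂ (LinearMap.mk₂ ℂ (tensorOp J) (tensorOp_add_left hJ)
      (tensorOp_smul_left hJ) (tensorOp_add_right hJ) (tensorOp_smul_right hJ)) 4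
      (norm_tensorOp_le hJ)
  have hc : IsClosed (compactOperator (RingHom.id ℂ) H H : Set (H →L[ℂ] H)) :=
    isClosed_setOfPred_isCompactOperator
  have h1 : ∀ x y, IsCompactOperator (tensorOp J (InnerProductSpace.rankOne ℂ x y) k') := by
    intro x y
    refine compact_mem_of_rankOne hk' ((compactOperator (RingHom.id ℂ) H H).comap
      (B (InnerProductSpace.rankOne ℂ x y)).toLinearMap)
      (hc.preimage (B (InnerProductSpace.rankOne ℂ x y)).continuous) fun x' y' => ?_
    change IsCompactOperator (tensorOp J _ _)
    rw [tensorOp_rankOne hJ]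
    exact isCompactOperator_rankOne _ _
  exact compact_mem_of_rankOne hk ((compactOperator (RingHom.id ℂ) H H).comap
      (B.flip k').toLinearMap) (hc.preimage (B.flip k').continuous) h1

end TensorOp

section FockOperators

variable (V : Type) [NormedAddCommGroup V] [InnerProductSpace ℝ V] [FiniteDimensional ℝ V]
variable (W : Type) [NormedAddCommGroup W] [InnerProductSpace ℝ W] [FiniteDimensional ℝ W]

/-- The Hilbert space `ℋ_V`, the completion of `Sym (V_ℂ)`. -/
def Fock : Type := UniformSpace.Completion (SymC V)

instance : NormedAddCommGroup (Fock V) :=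
  inferInstanceAs (NormedAddCommGroup (UniformSpace.Completion (SymC V)))
instance : InnerProductSpace ℂ (Fock V) :=
  inferInstanceAs (InnerProductSpace ℂ (UniformSpace.Completion (SymC V)))
instance : CompleteSpace (Fock V) :=
  inferInstanceAs (CompleteSpace (UniformSpace.Completion (SymC V)))

/-- The orthogonal sum of two inner product spaces. -/
abbrev OSum : Type := WithLp 2 (V × W)

/-- The inclusion of the first summand. -/
def inl : V →ₗᵢ[ℝ] OSum V W where
  toFun v := WithLp.toLp 2 (v, 0)
  map_add' x y := WithLp.ofLp_injective 2 (by simp)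
  map_smul' c x := WithLp.ofLp_injective 2 (by simp)
  norm_map' x := by simp

/-- The inclusion of the second summand. -/
def inr : W →ₗᵢ[ℝ] OSum V W where
  toFun w := WithLp.toLp 2 (0, w)
  map_add' x y := WithLp.ofLp_injective 2 (by simp)
  map_smul' c x := WithLp.ofLp_injective 2 (by simp)
  norm_map' x := by simp

variable {V W}

/-- The inclusion of `Sym (V_ℂ)` into its completion `ℋ_V`. -/
def Fock.of : SymC V →ₗᵢ[ℂ] Fock V := UniformSpace.Completion.toComplₗᵢ

lemma Fock.denseRange_of : DenseRange (Fock.of (V := V)) :=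
  UniformSpace.Completion.denseRange_coe

lemma Fock.ext_isClosed {P : Fock V → Prop} (x : Fock V) (hP : IsClosed {x | P x})
    (h : ∀ p : SymC V, P (Fock.of p)) : P x :=
  Fock.denseRange_of.induction_on x hP h

lemma Fock.inner_of (p q : SymC V) : ⟪Fock.of p, Fock.of q⟫_ℂ = SymC.form p q :=
  (LinearIsometry.inner_map_map Fock.of p q).trans (SymC.inner_eq p q)

/-- The class of `1 ∈ Sym (V_ℂ)`. -/
def Fock.vac : Fock V := Fock.of 1

/-- The isomorphism of symmetric algebras induced by a linear isometry. -/
def SymC.mapEquiv (φ : V ≃ₗᵢ[ℝ] W) : SymC V ≃ₗ[ℂ] SymC W :=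
  LinearEquiv.ofLinearMap (SymC.map φ.toLinearIsometry).toLinearMap
    (SymC.map φ.symm.toLinearIsometry).toLinearMap
    (by
      ext p
      induction p using SymC.induction with
      | h1 => simp
      | hadd p q hp hq => simp only [map_add, hp, hq]
      | hsmul z p hp => simp only [map_smul, hp]
      | hι x p hp =>
        simp only [LinearMap.comp_apply, AlgHom.toLinearMap_apply, LinearMap.id_apply, map_mul,
          SymC.map_ι] at *
        rw [hp]; simp)
    (by
      ext p
      induction p using SymC.induction with
      | h1 => simp
      | hadd p q hp hq => simp only [map_add, hp, hq]
      | hsmul z p hp => simp only [map_smul, hp]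
      | hι x p hp =>
        simp only [LinearMap.comp_apply, AlgHom.toLinearMap_apply, LinearMap.id_apply, map_mul,
          SymC.map_ι] at *
        rw [hp]; simp)

lemma SymC.mapEquiv_apply (φ : V ≃ₗᵢ[ℝ] W) (p : SymC V) :
    SymC.mapEquiv φ p = SymC.map φ.toLinearIsometry p := rfl

/-- The unitary `ℋ_V ≃ ℋ_W` induced by a linear isometry `V ≃ W`. -/
def Fock.map (φ : V ≃ₗᵢ[ℝ] W) : Fock V ≃ₗᵢ[ℂ] Fock W :=
  (SymC.mapEquiv φ).extendOfIsometry
    (Fock.of (V := V)).toLinearMap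
    (Fock.of (V := W)).toLinearMap
    Fock.denseRange_of Fock.denseRange_of
    (fun p => by simp [SymC.mapEquiv_apply, SymC.norm_map])

lemma Fock.map_coe (φ : V ≃ₗᵢ[ℝ] W) (p : SymC V) :
    Fock.map φ (Fock.of p) = Fock.of (SymC.map φ.toLinearIsometry p) :=
  LinearEquiv.extendOfIsometry_eq (SymC.mapEquiv φ)
    (Fock.of (V := V)).toLinearMap
    (Fock.of (V := W)).toLinearMap
    Fock.denseRange_of Fock.denseRange_of _ p

lemma Fock.map_vac (φ : V ≃ₗᵢ[ℝ] W) : Fock.map φ Fock.vac = Fock.vac := by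
  rw [Fock.vac, Fock.map_coe, map_one, Fock.vac]

/-- `SymC.ψ` as a conjugate-linear equivalence. -/
def SymC.ψEquiv : SymC V ≃ₛₗ[starRingEnd ℂ] SymC V :=
  LinearEquiv.ofInvolutive SymC.ψ SymC.ψ_ψ

/-- Complex conjugation on `ℋ_V`, the extension of `SymC.ψ` to a conjugate-linear isometry. -/
def Fock.ψ : Fock V ≃ₛₗᵢ[starRingEnd ℂ] Fock V :=
  SymC.ψEquiv.extendOfIsometry
    (Fock.of (V := V)).toLinearMap
    (Fock.of (V := V)).toLinearMap
    Fock.denseRange_of Fock.denseRange_of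
    (fun p => by
      change ‖Fock.of (SymC.ψ p)‖ = ‖Fock.of p‖
      rw [LinearIsometry.norm_map, LinearIsometry.norm_map, SymC.norm_ψ])

lemma Fock.ψ_coe (p : SymC V) : Fock.ψ (Fock.of p) = Fock.of (SymC.ψ p) :=
  LinearEquiv.extendOfIsometry_eq SymC.ψEquiv
    (Fock.of (V := V)).toLinearMap
    (Fock.of (V := V)).toLinearMap
    Fock.denseRange_of Fock.denseRange_of _ p

lemma Fock.ψ_vac : Fock.ψ (Fock.vac : Fock V) = Fock.vac := by
  rw [Fock.vac, Fock.ψ_coe, SymC.ψ_one]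

lemma Fock.ψ_ψ (x : Fock V) : Fock.ψ (Fock.ψ x) = x := by
  refine Fock.ext_isClosed (P := fun x => Fock.ψ (Fock.ψ x) = x) x
    (isClosed_eq (Fock.ψ.continuous.comp Fock.ψ.continuous) continuous_id) fun p => ?_
  rw [Fock.ψ_coe, Fock.ψ_coe, SymC.ψ_ψ]

lemma Fock.inner_ψ (x y : Fock V) : ⟪Fock.ψ x, Fock.ψ y⟫_ℂ = conj ⟪x, y⟫_ℂ := by
  refine Fock.ext_isClosed (P := fun x => ⟪Fock.ψ x, Fock.ψ y⟫_ℂ = conj ⟪x, y⟫_ℂ) x (isClosed_eq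
    ((Fock.ψ.continuous).inner continuous_const)
    (Complex.continuous_conj.comp (continuous_id.inner continuous_const))) fun p => ?_
  refine Fock.ext_isClosed (P := fun y => ⟪Fock.ψ (Fock.of p), Fock.ψ y⟫_ℂ = conj ⟪Fock.of p, y⟫_ℂ)
    y (isClosed_eq (continuous_const.inner Fock.ψ.continuous)
    (Complex.continuous_conj.comp (continuous_const.inner continuous_id))) fun q => ?_
  rw [Fock.ψ_coe, Fock.ψ_coe, Fock.inner_of, Fock.inner_of, SymC.form_ψ]

/-- The product `Sym (V_ℂ) × Sym (W_ℂ) → Sym ((V ⊕ W)_ℂ)`. -/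
def SymC.mul : SymC V →ₗ[ℂ] SymC W →ₗ[ℂ] SymC (OSum V W) :=
  (LinearMap.mul ℂ (SymC (OSum V W))).compl₁₂ (SymC.map (inl V W)).toLinearMap
    (SymC.map (inr V W)).toLinearMap

lemma SymC.mul_apply (p : SymC V) (q : SymC W) :
    SymC.mul p q = SymC.map (inl V W) p * SymC.map (inr V W) q := rfl

lemma SymC.form_mul (p p' : SymC V) (q q' : SymC W) :
    SymC.form (SymC.mul p q) (SymC.mul p' q') = SymC.form p p' * SymC.form q q' :=
  SymC.form_mul_mul (inl V W) (inr V W) (fun x y => by simp [inl, inr]) p p' q q'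

lemma SymC.norm_mul (p : SymC V) (q : SymC W) : ‖SymC.mul p q‖ = ‖p‖ * ‖q‖ := by
  have h : ‖SymC.mul p q‖ ^ 2 = (‖p‖ * ‖q‖) ^ 2 := by
    have h1 : ((‖SymC.mul p q‖ ^ 2 : ℝ) : ℂ) = ((‖p‖ * ‖q‖) ^ 2 : ℝ) := by
      have h2 := inner_self_eq_norm_sq_to_K (𝕜 := ℂ) (SymC.mul p q)
      rw [SymC.inner_eq, SymC.form_mul, ← SymC.inner_eq, ← SymC.inner_eq,
        inner_self_eq_norm_sq_to_K, inner_self_eq_norm_sq_to_K] at h2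
      push_cast
      rw [mul_pow]
      exact h2.symm
    exact_mod_cast h1
  exact (pow_left_inj₀ (by positivity) (by positivity) two_ne_zero).1 h

/-- The product on symmetric algebras as a continuous bilinear map with values in `ℋ_(V ⊕ W)`. -/
def SymC.mulFock : SymC V →L[ℂ] SymC W →L[ℂ] Fock (OSum V W) :=
  LinearMap.mkContinuous₂ (SymC.mul.compr₂ (Fock.of (V := OSum V W)).toLinearMap) 1
    (fun p q => by
      rw [one_mul, ← SymC.norm_mul]
      exact le_of_eq (LinearIsometry.norm_map Fock.of (SymC.mul p q)))

/-- The continuous bilinear extension `ℋ_V × ℋ_W → ℋ_(V ⊕ W)` of the product. -/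
def Fock.mul : Fock V →L[ℂ] Fock W →L[ℂ] Fock (OSum V W) :=
  (((SymC.mulFock.extend Fock.of.toContinuousLinearMap).flip).extend
    Fock.of.toContinuousLinearMap).flip

lemma Fock.mul_coe (p : SymC V) (q : SymC W) :
    Fock.mul (Fock.of p) (Fock.of q) = Fock.of (SymC.mul p q) := by
  have h1 := ContinuousLinearMap.extend_eq
    (e := (Fock.of (V := W)).toContinuousLinearMap)
    ((SymC.mulFock (V := V) (W := W)).extend Fock.of.toContinuousLinearMap).flip
    Fock.denseRange_of (Fock.of (V := W)).isometry.isUniformInducing q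
  have h2 := ContinuousLinearMap.extend_eq
    (e := (Fock.of (V := V)).toContinuousLinearMap) (SymC.mulFock (V := V) (W := W))
    Fock.denseRange_of (Fock.of (V := V)).isometry.isUniformInducing p
  have h3 := DFunLike.congr_fun h1 (Fock.of p)
  refine h3.trans ?_
  exact DFunLike.congr_fun h2 q

lemma Fock.inner_mul (x x' : Fock V) (y y' : Fock W) :
    ⟪Fock.mul x y, Fock.mul x' y'⟫_ℂ = ⟪x, x'⟫_ℂ * ⟪y, y'⟫_ℂ := by
  refine Fock.ext_isClosed
    (P := fun x => ⟪Fock.mul x y, Fock.mul x' y'⟫_ℂ = ⟪x, x'⟫_ℂ * ⟪y, y'⟫_ℂ) x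
    (isClosed_eq (by fun_prop) (by fun_prop)) fun p => ?_
  refine Fock.ext_isClosed
    (P := fun x' => ⟪Fock.mul (Fock.of p) y, Fock.mul x' y'⟫_ℂ = ⟪Fock.of p, x'⟫_ℂ * ⟪y, y'⟫_ℂ) x'
    (isClosed_eq (by fun_prop) (by fun_prop)) fun p' => ?_
  refine Fock.ext_isClosed
    (P := fun y => ⟪Fock.mul (Fock.of p) y, Fock.mul (Fock.of p') y'⟫_ℂ =
      ⟪Fock.of p, Fock.of p'⟫_ℂ * ⟪y, y'⟫_ℂ) y
    (isClosed_eq (by fun_prop) (by fun_prop)) fun q => ?_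
  refine Fock.ext_isClosed
    (P := fun y' => ⟪Fock.mul (Fock.of p) (Fock.of q), Fock.mul (Fock.of p') y'⟫_ℂ =
      ⟪Fock.of p, Fock.of p'⟫_ℂ * ⟪Fock.of q, y'⟫_ℂ) y'
    (isClosed_eq (by fun_prop) (by fun_prop)) fun q' => ?_
  rw [Fock.mul_coe, Fock.mul_coe, Fock.inner_of, Fock.inner_of, Fock.inner_of, SymC.form_mul]

/-- The isometric embedding with dense image of the algebraic tensor product `ℋ_V ⊗ ℋ_W` into
`ℋ_(V ⊕ W)`. -/
def Fock.tensor : Fock V ⊗[ℂ] Fock W →ₗᵢ[ℂ] Fock (OSum V W) :=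
  LinearMap.isometryOfInner (TensorProduct.lift (Fock.mul (V := V) (W := W)).toLinearMap₁₂)
    (fun s t => by
      induction s using TensorProduct.induction_on with
      | zero => simp
      | add a b ha hb => rw [map_add, inner_add_left, inner_add_left, ha, hb]
      | tmul x y =>
        induction t using TensorProduct.induction_on with
        | zero => simp
        | add a b ha hb => rw [map_add, inner_add_right, inner_add_right, ha, hb]
        | tmul x' y' =>
          rw [TensorProduct.inner_tmul]
          exact Fock.inner_mul x x' y y')

lemma Fock.tensor_tmul (x : Fock V) (y : Fock W) : Fock.tensor (x ⊗ₜ y) = Fock.mul x y := rfl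

lemma Fock.denseRange_tensor : DenseRange (Fock.tensor (V := V) (W := W)) := by
  have hs : ∀ p : SymC (OSum V W), ∃ t : SymC V ⊗[ℂ] SymC W, TensorProduct.lift SymC.mul t = p := by
    intro p
    induction p using SymC.induction with
    | h1 => exact ⟨1 ⊗ₜ 1, by simp [SymC.mul_apply]⟩
    | hadd p q hp hq =>
      obtain ⟨s, rfl⟩ := hp
      obtain ⟨t, rfl⟩ := hq
      exact ⟨s + t, map_add _ _ _⟩
    | hsmul z p hp =>
      obtain ⟨s, rfl⟩ := hp
      exact ⟨z • s, map_smul _ _ _⟩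
    | hι x p hp =>
      obtain ⟨s, rfl⟩ := hp
      have hx : SymC.ι x = SymC.map (inl V W) (SymC.ι x.fst) + SymC.map (inr V W) (SymC.ι x.snd) := by
        have h : x = inl V W x.fst + inr V W x.snd := by
          exact WithLp.ofLp_injective 2 (by simp [inl, inr]; rfl)
        have ha : ∀ a b : OSum V W, SymC.ι (a + b) = SymC.ι a + SymC.ι b := fun a b => by
          rw [SymC.ι, TensorProduct.tmul_add]
          exact map_add _ _ _
        rw [SymC.map_ι, SymC.map_ι, ← ha, ← h]
      induction s using TensorProduct.induction_on with
      | zero => exact ⟨0, by simp⟩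
      | add a b ha hb =>
        obtain ⟨s, hs⟩ := ha
        obtain ⟨t, ht⟩ := hb
        exact ⟨s + t, by rw [map_add, hs, ht, map_add, mul_add]⟩
      | tmul a b =>
        refine ⟨(SymC.ι x.fst * a) ⊗ₜ b + a ⊗ₜ (SymC.ι x.snd * b), ?_⟩
        rw [map_add, TensorProduct.lift.tmul, TensorProduct.lift.tmul, TensorProduct.lift.tmul,
          SymC.mul_apply, SymC.mul_apply, SymC.mul_apply, map_mul, map_mul, hx]
        ring
  refine Fock.denseRange_of.mono ?_
  rintro _ ⟨p, rfl⟩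
  obtain ⟨t, rfl⟩ := hs p
  induction t using TensorProduct.induction_on with
  | zero => exact ⟨0, by rw [map_zero, map_zero, map_zero]⟩
  | add a b ha hb =>
    obtain ⟨s, hs⟩ := ha
    obtain ⟨t, ht⟩ := hb
    exact ⟨s + t, by rw [map_add, hs, ht, map_add, map_add]⟩
  | tmul a b => exact ⟨Fock.of a ⊗ₜ Fock.of b, Fock.mul_coe a b⟩

/-! ### The compact operators on `ℋ_V` -/

variable (V) in
/-- The *-algebra `𝒦_V` of compact operators on `ℋ_V`. -/
def KOp : Type := Compacts (Fock V)

instance : NonUnitalNormedRing (KOp V) :=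
  Compacts.instRing (Fock V)
instance : NormedSpace ℂ (KOp V) :=
  Compacts.instModule (Fock V)
instance : IsScalarTower ℂ (KOp V) (KOp V) :=
  inferInstanceAs (IsScalarTower ℂ (Compacts (Fock V)) (Compacts (Fock V)))
instance : SMulCommClass ℂ (KOp V) (KOp V) :=
  inferInstanceAs (SMulCommClass ℂ (Compacts (Fock V)) (Compacts (Fock V)))
instance : StarRing (KOp V) := inferInstanceAs (StarRing (Compacts (Fock V)))
instance : StarModule ℂ (KOp V) := inferInstanceAs (StarModule ℂ (Compacts (Fock V)))

/-- The bounded operator underlying an element of `𝒦_V`. -/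
def KOp.op (k : KOp V) : Fock V →L[ℂ] Fock V := Subtype.val k

/-- A compact operator as an element of `𝒦_V`. -/
def KOp.of (T : Fock V →L[ℂ] Fock V) (hT : IsCompactOperator T) : KOp V := ⟨T, hT⟩

lemma KOp.isCompactOperator (k : KOp V) : IsCompactOperator k.op := k.2

@[simp] lemma KOp.op_of (T : Fock V →L[ℂ] Fock V) (hT : IsCompactOperator T) :
    (KOp.of T hT).op = T := rfl
@[simp] lemma KOp.op_add (k l : KOp V) : (k + l).op = k.op + l.op := rfl
@[simp] lemma KOp.op_smul (z : ℂ) (k : KOp V) : (z • k).op = z • k.op := rfl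
@[simp] lemma KOp.op_mul (k l : KOp V) : (k * l).op = k.op * l.op := rfl
@[simp] lemma KOp.op_star (k : KOp V) : (star k).op = ContinuousLinearMap.adjoint k.op := rfl

lemma KOp.ext' {k l : KOp V} (h : ∀ x, k.op x = l.op x) : k = l :=
  Subtype.ext (ContinuousLinearMap.ext h)

/-- The orthogonal projection `p₀ ∈ 𝒦_V` onto the constant summand of the symmetric algebra. -/
def KOp.p₀ : KOp V :=
  KOp.of (InnerProductSpace.rankOne ℂ Fock.vac Fock.vac) (isCompactOperator_rankOne _ _)

/-- The unitary `ℋ_V → ℋ_W` as a bounded operator. -/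
def Fock.mapL (φ : V ≃ₗᵢ[ℝ] W) : Fock V →L[ℂ] Fock W :=
  (Fock.map φ).toLinearIsometry.toContinuousLinearMap

/-- The inverse unitary `ℋ_W → ℋ_V` as a bounded operator. -/
def Fock.mapSymmL (φ : V ≃ₗᵢ[ℝ] W) : Fock W →L[ℂ] Fock V :=
  (Fock.map φ).symm.toLinearIsometry.toContinuousLinearMap

@[simp] lemma Fock.mapL_apply (φ : V ≃ₗᵢ[ℝ] W) (x : Fock V) : Fock.mapL φ x = Fock.map φ x := rfl
@[simp] lemma Fock.mapSymmL_apply (φ : V ≃ₗᵢ[ℝ] W) (x : Fock W) :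
    Fock.mapSymmL φ x = (Fock.map φ).symm x := rfl

/-- The isomorphism `𝒦_V → 𝒦_W`, `k ↦ φ k φ⁻¹`, induced by a linear isometry `φ : V ≃ W`. -/
def KOp.map (φ : V ≃ₗᵢ[ℝ] W) : KOp V →ₗ[ℂ] KOp W where
  toFun k := KOp.of (Fock.mapL φ ∘L k.op ∘L Fock.mapSymmL φ)
    (IsCompactOperator.clm_comp (IsCompactOperator.comp_clm k.isCompactOperator _) _)
  map_add' k l := KOp.ext' fun x => by simp; rfl
  map_smul' z k := KOp.ext' fun x => by simp; rfl

lemma KOp.map_apply (φ : V ≃ₗᵢ[ℝ] W) (k : KOp V) (x : Fock W) :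
    (KOp.map φ k).op x = Fock.map φ (k.op ((Fock.map φ).symm x)) := rfl

lemma KOp.map_mul (φ : V ≃ₗᵢ[ℝ] W) (k l : KOp V) :
    KOp.map φ (k * l) = KOp.map φ k * KOp.map φ l :=
  KOp.ext' fun x => by simp [KOp.map_apply]

lemma KOp.map_star (φ : V ≃ₗᵢ[ℝ] W) (k : KOp V) : KOp.map φ (star k) = star (KOp.map φ k) := by
  refine KOp.ext' fun x => ext_inner_left ℂ fun y => ?_
  rw [KOp.map_apply, KOp.op_star, KOp.op_star, ContinuousLinearMap.adjoint_inner_right,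
    KOp.map_apply, ← LinearIsometryEquiv.inner_map_map (Fock.map φ).symm y,
    LinearIsometryEquiv.symm_apply_apply, ContinuousLinearMap.adjoint_inner_right,
    ← LinearIsometryEquiv.inner_map_map (Fock.map φ).symm (Fock.map φ _) x,
    LinearIsometryEquiv.symm_apply_apply]

/-- The conjugation of `ℋ_V` as a continuous conjugate-linear map. -/
def Fock.ψL : Fock V →SL[starRingEnd ℂ] Fock V :=
  (Fock.ψ (V := V)).toLinearIsometry.toContinuousLinearMap

@[simp] lemma Fock.ψL_apply (x : Fock V) : Fock.ψL x = Fock.ψ x := rfl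

/-- The conjugate-linear automorphism `k ↦ ψ k ψ` of `𝒦_V`. -/
def KOp.ψ : KOp V →ₛₗ[starRingEnd ℂ] KOp V where
  toFun k := KOp.of (Fock.ψL.comp (k.op.comp Fock.ψL))
    (IsCompactOperator.clm_comp (IsCompactOperator.comp_clm k.isCompactOperator _) _)
  map_add' k l := KOp.ext' fun x => by simp; rfl
  map_smul' z k := KOp.ext' fun x => by simp; rfl

lemma KOp.ψ_apply (k : KOp V) (x : Fock V) : (KOp.ψ k).op x = Fock.ψ (k.op (Fock.ψ x)) := rfl

lemma KOp.ψ_mul (k l : KOp V) : KOp.ψ (k * l) = KOp.ψ k * KOp.ψ l :=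
  KOp.ext' fun x => by simp [KOp.ψ_apply, Fock.ψ_ψ]

lemma KOp.ψ_star (k : KOp V) : KOp.ψ (star k) = star (KOp.ψ k) := by
  refine KOp.ext' fun x => ext_inner_left ℂ fun y => ?_
  rw [KOp.ψ_apply, KOp.op_star, KOp.op_star, ContinuousLinearMap.adjoint_inner_right,
    KOp.ψ_apply]
  nth_rw 1 [← Fock.ψ_ψ y]
  rw [Fock.inner_ψ, ContinuousLinearMap.adjoint_inner_right, ← Fock.inner_ψ, Fock.ψ_ψ]

/-- The operator `k ⊗ k'` on `ℋ_(V ⊕ W) = ℋ_V ⊗ ℋ_W`. -/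
def KOp.mul : KOp V →ₗ[ℂ] KOp W →ₗ[ℂ] KOp (OSum V W) :=
  LinearMap.mk₂ ℂ (fun (k : KOp V) (k' : KOp W) => KOp.of (tensorOp Fock.tensor k.op k'.op)
      (isCompactOperator_tensorOp Fock.denseRange_tensor k.isCompactOperator k'.isCompactOperator))
    (fun _ _ _ => Subtype.ext (tensorOp_add_left Fock.denseRange_tensor _ _ _))
    (fun _ _ _ => Subtype.ext (tensorOp_smul_left Fock.denseRange_tensor _ _ _))
    (fun _ _ _ => Subtype.ext (tensorOp_add_right Fock.denseRange_tensor _ _ _))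
    (fun _ _ _ => Subtype.ext (tensorOp_smul_right Fock.denseRange_tensor _ _ _))

lemma KOp.mul_apply (k : KOp V) (k' : KOp W) (x : Fock V) (y : Fock W) :
    (KOp.mul k k').op (Fock.mul x y) = Fock.mul (k.op x) (k'.op y) :=
  tensorOp_apply Fock.denseRange_tensor k.op k'.op (x ⊗ₜ y)

end FockOperators

/-! ### The spaces `KR(V)` -/

section KRSpaces

variable (V : Type) [NormedAddCommGroup V] [InnerProductSpace ℝ V] [FiniteDimensional ℝ V]
variable (W : Type) [NormedAddCommGroup W] [InnerProductSpace ℝ W] [FiniteDimensional ℝ W]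

/-- The complex *-algebra `Cl V ⊗ 𝒦_V`. -/
def KA : Type := Cl V ⊗[ℂ] KOp V

instance : NonUnitalRing (KA V) := inferInstanceAs (NonUnitalRing (Cl V ⊗[ℂ] KOp V))
instance : Module ℂ (KA V) := inferInstanceAs (Module ℂ (Cl V ⊗[ℂ] KOp V))

/-- The *-involution, `(c ⊗ k)* = c* ⊗ k*`. -/
instance : StarAddMonoid (KA V) := inferInstanceAs (StarAddMonoid (Cl V ⊗[ℂ] KOp V))

variable {V W}

/-- The element `c ⊗ k` of `Cl V ⊗ 𝒦_V`. -/
def KA.mk (c : Cl V) (k : KOp V) : KA V := c ⊗ₜ[ℂ] k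

@[elab_as_elim]
lemma KA.induction {P : KA V → Prop} (x : KA V) (h0 : P 0) (h1 : ∀ c k, P (KA.mk c k))
    (h2 : ∀ x y, P x → P y → P (x + y)) : P x :=
  TensorProduct.induction_on (motive := P) x h0 h1 h2

lemma KA.mk_mul_mk (c d : Cl V) (k l : KOp V) : KA.mk c k * KA.mk d l = KA.mk (c * d) (k * l) :=
  Algebra.TensorProduct.tmul_mul_tmul (R := ℂ) c d k l

lemma KA.star_mk (c : Cl V) (k : KOp V) : star (KA.mk c k) = KA.mk (star c) (star k) :=
  TensorProduct.star_tmul c k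

/-- The slice map `l ⊗ id : Cl V ⊗ 𝒦_V → 𝒦_V` of a linear functional `l` on `Cl V`. -/
def KA.slice (l : Module.Dual ℂ (Cl V)) : KA V →ₗ[ℂ] KOp V :=
  TensorProduct.lift (LinearMap.lsmul ℂ (KOp V) ∘ₗ l)

lemma KA.slice_mk (l : Module.Dual ℂ (Cl V)) (c : Cl V) (k : KOp V) :
    KA.slice l (KA.mk c k) = l c • k := rfl

/-- As `Cl V` is finite-dimensional, the tensor product `Cl V ⊗ 𝒦_V` is a finite direct sum of
copies of the Banach space `𝒦_V` and thus needs no completion. It carries the topology of this direct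
sum, the coarsest topology that makes all slice maps continuous; it is the topology of the norm of the
C*-algebra `Cl V ⊗ 𝒦_V`. -/
instance : TopologicalSpace (KA V) :=
  ⨅ l : Module.Dual ℂ (Cl V), TopologicalSpace.induced (KA.slice l) inferInstance

/-- The grading involution of `Cl V ⊗ 𝒦_V`, where `𝒦_V` is concentrated in even degree. -/
def KA.α : KA V →ₗ[ℂ] KA V := TensorProduct.map Cl.α.toLinearMap LinearMap.id

/-- The conjugate-linear multiplicative involution `ψ ⊗ (-)^ψ` of `Cl V ⊗ 𝒦_V`. -/
def KA.ψ : KA V →ₛₗ[starRingEnd ℂ] KA V := TensorProduct.map Cl.ψ KOp.ψ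

lemma KA.α_mk (c : Cl V) (k : KOp V) : KA.α (KA.mk c k) = KA.mk (Cl.α c) k := rfl

lemma KA.ψ_mk (c : Cl V) (k : KOp V) : KA.ψ (KA.mk c k) = KA.mk (Cl.ψ c) (KOp.ψ k) := rfl

/-- The isomorphism `Cl V ⊗ 𝒦_V → Cl W ⊗ 𝒦_W` induced by a linear isometry `V ≃ W`. -/
def KA.map (φ : V ≃ₗᵢ[ℝ] W) : KA V →ₗ[ℂ] KA W :=
  TensorProduct.map (Cl.map φ.toLinearIsometry).toLinearMap (KOp.map φ)

lemma KA.map_mk (φ : V ≃ₗᵢ[ℝ] W) (c : Cl V) (k : KOp V) :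
    KA.map φ (KA.mk c k) = KA.mk (Cl.map φ.toLinearIsometry c) (KOp.map φ k) := rfl

lemma KA.ψ_mul (x y : KA V) : KA.ψ (x * y) = KA.ψ x * KA.ψ y := by
  induction x using KA.induction with
  | h0 => simp
  | h2 x x' hx hx' => simp only [add_mul, map_add, hx, hx']
  | h1 c k =>
    induction y using KA.induction with
    | h0 => simp
    | h2 y y' hy hy' => simp only [mul_add, map_add, hy, hy']
    | h1 d l => rw [KA.mk_mul_mk, KA.ψ_mk, KA.ψ_mk, KA.ψ_mk, KA.mk_mul_mk, Cl.ψ_mul, KOp.ψ_mul]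

lemma KA.map_mul (φ : V ≃ₗᵢ[ℝ] W) (x y : KA V) : KA.map φ (x * y) = KA.map φ x * KA.map φ y := by
  induction x using KA.induction with
  | h0 => simp
  | h2 x x' hx hx' => simp only [add_mul, map_add, hx, hx']
  | h1 c k =>
    induction y using KA.induction with
    | h0 => simp
    | h2 y y' hy hy' => simp only [mul_add, map_add, hy, hy']
    | h1 d l =>
      rw [KA.mk_mul_mk, KA.map_mk, KA.map_mk, KA.map_mk, KA.mk_mul_mk, _root_.map_mul, KOp.map_mul]

lemma KA.ψ_star (x : KA V) : KA.ψ (star x) = star (KA.ψ x) := by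
  induction x using KA.induction with
  | h0 => simp
  | h1 c k => rw [KA.star_mk, KA.ψ_mk, KA.ψ_mk, KA.star_mk, Cl.ψ_star, KOp.ψ_star]
  | h2 x y hx hy => simp only [star_add, map_add, hx, hy]

lemma KA.map_star (φ : V ≃ₗᵢ[ℝ] W) (x : KA V) : KA.map φ (star x) = star (KA.map φ x) := by
  induction x using KA.induction with
  | h0 => simp
  | h1 c k => rw [KA.star_mk, KA.map_mk, KA.map_mk, KA.star_mk, Cl.map_star, KOp.map_star]
  | h2 x y hx hy => simp only [star_add, map_add, hx, hy]

lemma KA.ψ_α (x : KA V) : KA.ψ (KA.α x) = KA.α (KA.ψ x) := by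
  induction x using KA.induction with
  | h0 => simp
  | h1 c k => rw [KA.α_mk, KA.ψ_mk, KA.ψ_mk, KA.α_mk, Cl.ψ_α]
  | h2 x y hx hy => simp only [map_add, hx, hy]

lemma KA.map_α (φ : V ≃ₗᵢ[ℝ] W) (x : KA V) : KA.map φ (KA.α x) = KA.α (KA.map φ x) := by
  induction x using KA.induction with
  | h0 => simp
  | h1 c k => rw [KA.α_mk, KA.map_mk, KA.map_mk, KA.α_mk, Cl.map_α]
  | h2 x y hx hy => simp only [map_add, hx, hy]

variable (V) in
/-- The space `KR(V)` of graded *-homomorphisms `s → Cl V ⊗ 𝒦_V`. -/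
abbrev KR : Type := CstarGr (KA V) KA.α

/-- The basepoint of `KR(V)`, the zero homomorphism. -/
instance : Zero (KR V) := ⟨⟨0, fun _ => (map_zero KA.α).symm⟩⟩

/-- Functoriality of `KR` in linear isometries. -/
def KR.map (φ : V ≃ₗᵢ[ℝ] W) (h : KR V) : KR W :=
  ⟨{  toFun := fun f => KA.map φ (h.1 f)
      map_smul' := fun z f => by simp
      map_zero' := by simp
      map_add' := fun f g => by simp
      map_mul' := fun f g => by rw [_root_.map_mul, KA.map_mul]
      map_star' := fun f => (congrArg (KA.map φ) (map_star h.1 f)).trans (KA.map_star φ _) },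
    fun f => (congrArg (KA.map φ) (h.2 f)).trans (KA.map_α φ _)⟩

/-- The involution `h ↦ (ψ ⊗ (-)^ψ) ∘ h ∘ (-)*` of `KR(V)`. -/
def KR.conj (h : KR V) : KR V :=
  ⟨{  toFun := fun f => KA.ψ (h.1 (star f))
      map_smul' := fun z f => by simp
      map_zero' := by simp
      map_add' := fun f g => by simp
      map_mul' := fun f g => by rw [star_mul', _root_.map_mul, KA.ψ_mul]
      map_star' := fun f => (congrArg KA.ψ (map_star h.1 (star f))).trans (KA.ψ_star _) },
    fun f => (congrArg KA.ψ (h.2 (star f))).trans (KA.ψ_α _)⟩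

lemma KOp.p₀_mul_p₀ : (KOp.p₀ : KOp V) * KOp.p₀ = KOp.p₀ := by
  refine KOp.ext' fun x => ?_
  have h : ⟪(Fock.vac : Fock V), Fock.vac⟫_ℂ = 1 := by
    rw [Fock.vac, Fock.inner_of, SymC.form_one_one]
  rw [KOp.op_mul, KOp.p₀, KOp.op_of, mul_apply_eq_comp,
    InnerProductSpace.rankOne_apply, InnerProductSpace.rankOne_apply, inner_smul_right, h, mul_one]

lemma KOp.star_p₀ : star (KOp.p₀ : KOp V) = KOp.p₀ :=
  Subtype.ext (InnerProductSpace.adjoint_rankOne _ _)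

/-- The homomorphism `- ⊗ p₀ : Cl V → Cl V ⊗ 𝒦_V`. -/
def KA.mkP₀ : Cl V →⋆ₙₐ[ℂ] KA V where
  toFun c := KA.mk c KOp.p₀
  map_smul' _ _ := rfl
  map_zero' := TensorProduct.zero_tmul _ _
  map_add' c d := TensorProduct.add_tmul c d _
  map_mul' c d := by rw [KA.mk_mul_mk, KOp.p₀_mul_p₀]
  map_star' c := by rw [KA.star_mk, KOp.star_p₀]

/-- The unit map `η_V : S^V → KR(V)`, on the one-point compactification `S^V` of `V`. -/
def KR.η : OnePoint V → KR V
  | none => 0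
  | some v => ⟨KA.mkP₀.comp (fc v).1, fun f => congrArg (fun c => KA.mk c KOp.p₀) ((fc v).2 f)⟩

/-- The product `(Cl V ⊗ 𝒦_V) × (Cl W ⊗ 𝒦_W) → Cl (V ⊕ W) ⊗ 𝒦_(V ⊕ W)`,
`(c ⊗ k, d ⊗ l) ↦ (c · d) ⊗ (k ⊗ l)`, that corresponds to the isomorphism of the graded tensor product
of `Cl V` and `Cl W` with `Cl (V ⊕ W)`. -/
def KA.mul : KA V →ₗ[ℂ] KA W →ₗ[ℂ] KA (OSum V W) :=
  TensorProduct.map₂ ((LinearMap.mul ℂ (Cl (OSum V W))).compl₁₂ (Cl.map (inl V W)).toLinearMap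
    (Cl.map (inr V W)).toLinearMap) KOp.mul

lemma KA.mul_mk (c : Cl V) (k : KOp V) (d : Cl W) (l : KOp W) :
    KA.mul (KA.mk c k) (KA.mk d l) =
      KA.mk (Cl.map (inl V W) c * Cl.map (inr V W) d) (KOp.mul k l) := rfl

/-- `h : s → Cl (V ⊕ W) ⊗ 𝒦_(V ⊕ W)` is the product of `f ∈ KR(V)` and `g ∈ KR(W)`, i.e., the
composite of the comultiplication `Δ : s → s ⊗ s` (graded tensor product) and `f ⊗ g`. The
comultiplication is determined by `Δ u = u ⊗ u` and `Δ v = u ⊗ v + v ⊗ u` for the generators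
`u = exp (-x²)` and `v = x exp (-x²)` of the C*-algebra `s`. -/
def IsGradedProduct (f : KR V) (g : KR W) (h : KR (OSum V W)) : Prop :=
  h.1 uFun = KA.mul (f.1 uFun) (g.1 uFun) ∧
    h.1 vFun = KA.mul (f.1 uFun) (g.1 vFun) + KA.mul (f.1 vFun) (g.1 uFun)

end KRSpaces

/-! ### Orthogonal representations of `C` -/

/-- An orthogonal representation of `C = Gal(ℂ/ℝ)`: a finite-dimensional real inner product space
with an involutive linear isometry `τ`, by which the generator of the group `C` of order two acts. -/
structure CRep where
  carrier : Type
  [normedAddCommGroup : NormedAddCommGroup carrier]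
  [innerProductSpace : InnerProductSpace ℝ carrier]
  [finiteDimensional : FiniteDimensional ℝ carrier]
  τ : carrier ≃ₗᵢ[ℝ] carrier
  τ_τ : ∀ v, τ (τ v) = v

instance : CoeSort CRep Type := ⟨CRep.carrier⟩
instance (V : CRep) : NormedAddCommGroup V := V.normedAddCommGroup
instance (V : CRep) : InnerProductSpace ℝ V := V.innerProductSpace
instance (V : CRep) : FiniteDimensional ℝ V := V.finiteDimensional

/-- The direct sum of two representations. -/
def CRep.sum (V W : CRep) : CRep where
  carrier := OSum V W
  τ := LinearIsometryEquiv.withLpProdCongr 2 V.τ W.τ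
  τ_τ x := WithLp.ofLp_injective 2 (Prod.ext (V.τ_τ x.fst) (W.τ_τ x.snd))

/-- The zero representation. -/
def CRep.zero : CRep where
  carrier := EuclideanSpace ℝ (Fin 0)
  τ := LinearIsometryEquiv.refl ℝ _
  τ_τ _ := rfl

/-- The sign representation `σ` on `ℝ`. -/
def CRep.sign : CRep where
  carrier := ℝ
  τ := LinearIsometryEquiv.neg ℝ
  τ_τ x := neg_neg x

/-- The element `(v, w)` of `V ⊕ W`. -/
def CRep.pair {V W : CRep} (v : V) (w : W) : CRep.sum V W := WithLp.toLp 2 (v, w)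

section Coherence

variable (U V W X : Type) [NormedAddCommGroup U] [InnerProductSpace ℝ U]
  [NormedAddCommGroup V] [InnerProductSpace ℝ V] [NormedAddCommGroup W] [InnerProductSpace ℝ W]
  [NormedAddCommGroup X] [InnerProductSpace ℝ X]

/-- The isometry `(U ⊕ V) ⊕ W ≃ U ⊕ (V ⊕ W)`. -/
def assoc : OSum (OSum U V) W ≃ₗᵢ[ℝ] OSum U (OSum V W) :=
  LinearIsometryEquiv.withLpProdAssoc 2 ℝ U V W

/-- The isometry `(U ⊕ V) ⊕ (W ⊕ X) ≃ (U ⊕ W) ⊕ (V ⊕ X)` that interchanges the inner summands. -/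
def interchange : OSum (OSum U V) (OSum W X) ≃ₗᵢ[ℝ] OSum (OSum U W) (OSum V X) where
  toFun x := WithLp.toLp 2 (WithLp.toLp 2 (x.fst.fst, x.snd.fst), WithLp.toLp 2 (x.fst.snd, x.snd.snd))
  invFun x := WithLp.toLp 2
    (WithLp.toLp 2 (x.fst.fst, x.snd.fst), WithLp.toLp 2 (x.fst.snd, x.snd.snd))
  map_add' _ _ := rfl
  map_smul' _ _ := rfl
  left_inv _ := rfl
  right_inv _ := rfl
  norm_map' x := by
    change ‖(WithLp.toLp 2 (WithLp.toLp 2 (x.fst.fst, x.snd.fst),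
      WithLp.toLp 2 (x.fst.snd, x.snd.snd)) : OSum (OSum U W) (OSum V X))‖ = ‖x‖
    rw [← sq_eq_sq₀ (norm_nonneg _) (norm_nonneg _)]
    simp only [WithLp.prod_norm_sq_eq_of_L2]
    exact add_add_add_comm _ _ _ _

end Coherence

/-! ### Equivariant homotopy groups of `KR` -/

/-- The action of the generator of `C` on `KR(V)` for a representation `V`: it combines the involution
of `KR` with the functoriality of `KR` in the action on `V`. -/
def KR.act {V : CRep} (h : KR V) : KR V := KR.map V.τ (KR.conj h)

/-- The action of the generator of `C` on the sphere `S^V`. -/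
def CRep.sphereAct {V : CRep} (x : OnePoint V) : OnePoint V := x.map V.τ

/-- A continuous based `C`-equivariant map `S^U → KR(U ⊕ W)`, a representative of a class in
`π_{-W}^C(KR)`. -/
structure EqMap (U W : CRep) where
  toFun : OnePoint U → KR (CRep.sum U W)
  continuous : Continuous toFun
  map_infty : toFun OnePoint.infty = 0
  equivariant : ∀ x, toFun (CRep.sphereAct x) = KR.act (toFun x)

/-- The relation that generates the identifications between representatives of classes in
`π_{-W}^C(KR)`. -/
inductive EqMap.Rel {W : CRep} : (Σ U, EqMap U W) → (Σ U, EqMap U W) → Prop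
  /-- equivariant based homotopies -/
  | homotopy {U : CRep} (f g : EqMap U W) (H : unitInterval → EqMap U W)
      (hH : Continuous fun p : unitInterval × OnePoint U => (H p.1).toFun p.2)
      (h0 : (H 0).toFun = f.toFun) (h1 : (H 1).toFun = g.toFun) : Rel ⟨U, f⟩ ⟨U, g⟩
  /-- transport along equivariant isometries -/
  | transport {U U' : CRep} (φ : U ≃ₗᵢ[ℝ] U') (hφ : ∀ u, φ (U.τ u) = U'.τ (φ u))
      (f : EqMap U W) (g : EqMap U' W)
      (h : ∀ x : OnePoint U, g.toFun (x.map φ) = KR.map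
        (LinearIsometryEquiv.withLpProdCongr 2 φ (LinearIsometryEquiv.refl ℝ W)) (f.toFun x)) :
      Rel ⟨U, f⟩ ⟨U', g⟩
  /-- stabilization: `g` is the composite of `S^U' ∧ f : S^(U' ⊕ U) → S^U' ∧ KR(U ⊕ W)` and the
  structure map `S^U' ∧ KR(U ⊕ W) → KR(U' ⊕ U ⊕ W)`, which multiplies with `η` -/
  | stabilize (U' : CRep) {U : CRep} (f : EqMap U W) (g : EqMap (CRep.sum U' U) W)
      (h : ∀ (u' : U') (u : U), IsGradedProduct (KR.η (u' : OnePoint U')) (f.toFun (u : OnePoint U))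
        (KR.map (assoc U' U W) (g.toFun (CRep.pair u' u : CRep.sum U' U)))) :
      Rel ⟨U, f⟩ ⟨CRep.sum U' U, g⟩

/-- The equivariant homotopy group `π_{-W}^C(KR)`, the colimit over all representations `U` of the sets
of equivariant based homotopy classes of maps `S^U → KR(U ⊕ W)`. -/
def Pi (W : CRep) : Type 1 := Quot (EqMap.Rel (W := W))

/-- The class of a representative. -/
def EqMap.cls {U W : CRep} (f : EqMap U W) : Pi W := Quot.mk _ ⟨U, f⟩

lemma KR.act_zero {V : CRep} : KR.act (0 : KR V) = 0 :=
  Subtype.ext (DFunLike.ext _ _ fun _ =>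
    (congrArg (KA.map V.τ) (map_zero KA.ψ)).trans (map_zero _))

/-- The zero element of `π_{-W}^C(KR)`, the class of the constant map at the basepoint. -/
instance (W : CRep) : Zero (Pi W) := ⟨EqMap.cls (U := CRep.zero)
  { toFun := fun _ => 0
    continuous := continuous_const
    map_infty := rfl
    equivariant := fun _ => KR.act_zero.symm }⟩

lemma KOp.ψ_p₀ {V : CRep} : KOp.ψ (KOp.p₀ : KOp V) = KOp.p₀ := by
  refine KOp.ext' fun x => ?_
  rw [KOp.ψ_apply, KOp.p₀, KOp.op_of, InnerProductSpace.rankOne_apply,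
    InnerProductSpace.rankOne_apply, map_smulₛₗ, Fock.ψ_vac]
  congr 1
  rw [← Fock.inner_ψ, Fock.ψ_vac, Fock.ψ_ψ]

lemma KOp.map_p₀ {V : CRep} : KOp.map V.τ (KOp.p₀ : KOp V) = KOp.p₀ := by
  refine KOp.ext' fun x => ?_
  rw [KOp.map_apply, KOp.p₀, KOp.op_of, InnerProductSpace.rankOne_apply,
    InnerProductSpace.rankOne_apply, map_smul, Fock.map_vac]
  congr 1
  rw [← LinearIsometryEquiv.inner_map_map (Fock.map V.τ), Fock.map_vac,
    LinearIsometryEquiv.apply_symm_apply]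

lemma Cl.ψ_ι {V : CRep} (v : V) : Cl.ψ (Cl.ι v) = Cl.ι v := by
  rw [Cl.ι, Cl.ψ_mk, map_one]

/-- The unit maps are equivariant. -/
lemma KR.η_equivariant {V : CRep} (x : OnePoint V) :
    KR.η (CRep.sphereAct x) = KR.act (KR.η x) := by
  induction x using OnePoint.rec with
  | infty => exact KR.act_zero.symm
  | coe v =>
    refine Subtype.ext (DFunLike.ext _ _ fun f => ?_)
    change KA.mk ((fc (V.τ v)).1 f) KOp.p₀ =
      KA.map V.τ (KA.ψ (KA.mk ((fc v).1 (star f)) KOp.p₀))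
    rw [KA.ψ_mk, KA.map_mk, KOp.ψ_p₀, KOp.map_p₀]
    congr 1
    change evenPart f ‖V.τ v‖ • (1 : Cl V) + (oddPart f ‖V.τ v‖ / ‖V.τ v‖) • Cl.ι (V.τ v) =
      Cl.map V.τ.toLinearIsometry (Cl.ψ (evenPart (star f) ‖v‖ • (1 : Cl V) +
        (oddPart (star f) ‖v‖ / ‖v‖) • Cl.ι v))
    have h1 : Cl.ψ (1 : Cl V) = 1 := by rw [Cl.one_def, Cl.ψ_mk, map_one]
    simp only [map_add, map_smulₛₗ, h1, Cl.ψ_ι, Cl.map_ι, map_one,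
      LinearIsometryEquiv.norm_map, evenPart, oddPart, ZeroAtInftyContinuousMap.star_apply,
      RCLike.star_def, map_div₀, map_add, map_sub, Complex.conj_conj, Complex.conj_ofReal,
      map_ofNat, LinearIsometryEquiv.coe_toLinearIsometry, RingHom.id_apply]

instance : DiscreteTopology CRep.zero :=
  inferInstanceAs (DiscreteTopology (EuclideanSpace ℝ (Fin 0)))

/-- The pre-Euler class `a_W ∈ π_{-W}^C(KR)`: the class of the composite of the inclusion
`S^0 → S^W = S^(0 ⊕ W)` and the unit map `S^(0 ⊕ W) → KR(0 ⊕ W)`. -/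
def preEuler (W : CRep) : Pi W := EqMap.cls (U := CRep.zero)
  { toFun := fun x => KR.η (V := CRep.sum CRep.zero W) (x.map (inl CRep.zero W))
    continuous := by
      have : Finite CRep.zero := inferInstanceAs (Finite (EuclideanSpace ℝ (Fin 0)))
      rw [OnePoint.continuous_iff_from_discrete, Filter.cofinite_eq_bot]
      exact Filter.tendsto_bot
    map_infty := rfl
    equivariant := fun x => by
      rw [← KR.η_equivariant]
      congr 1
      induction x using OnePoint.rec with
      | infty => rfl
      | coe v =>
        refine congrArg OnePoint.some (WithLp.ofLp_injective 2 (Prod.ext rfl ?_))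
        exact (map_zero W.τ).symm }

/-- `z ∈ π_{-(W ⊕ W')}^C(KR)` is the product of `x ∈ π_{-W}^C(KR)` and `y ∈ π_{-W'}^C(KR)`: if
`f : S^U → KR(U ⊕ W)` represents `x` and `g : S^U' → KR(U' ⊕ W')` represents `y`, then `z` is
represented by the composite of
`f ∧ g : S^(U ⊕ U') → KR(U ⊕ W) ∧ KR(U' ⊕ W')`, the multiplication map to `KR(U ⊕ W ⊕ U' ⊕ W')` and
the isometry that interchanges the summands `W` and `U'`. -/
def IsMul {W W' : CRep} (x : Pi W) (y : Pi W') (z : Pi (CRep.sum W W')) : Prop :=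
  ∃ (U U' : CRep) (f : EqMap U W) (g : EqMap U' W')
    (k : EqMap (CRep.sum U U') (CRep.sum W W')),
    f.cls = x ∧ g.cls = y ∧ k.cls = z ∧ ∀ (u : U) (u' : U'),
      IsGradedProduct (f.toFun (u : OnePoint U)) (g.toFun (u' : OnePoint U'))
        (KR.map (interchange U U' W W') (k.toFun (CRep.pair u u' : CRep.sum U U')))

/-- The `C`-fixed points of the space `C*_gr(s, Cl V)` of graded *-homomorphisms, for a representation
`V`: the homomorphisms with `h = Cl(τ) ∘ ψ ∘ h ∘ (-)*`. -/
abbrev FixedPoints (V : CRep) : Type :=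
  {h : CstarGr (Cl V) Cl.α // ∀ f, h.1 f = Cl.map V.τ.toLinearIsometry (Cl.ψ (h.1 (star f)))}

end KRSpec

end

noncomputable section

namespace KRSpec

/-! Up to zero summands, a representative of a power of `a` is a map out of `S⁰`, so it amounts to a
single `C`-fixed point of `KR(nσ)`, and a path of fixed points is a homotopy. Evaluation at `0` is
compatible with the comultiplication, because `u(0) = 1` and `v(0) = 0`; hence this point is always
`η(0)`, the homomorphism `f ↦ f(0) • 1 ⊗ p₀` (`isGradedProduct_η_zero`, `EqMap.isMul_η₀`). So `a³ =
0` follows once `η(0)` is joined to the zero homomorphism through fixed points of `KR(3σ)`.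

Such a path exists already in `C*_gr(s, Cl(3σ))`. The element `ω = i[e₀][e₁][e₂]` is odd,
self-adjoint, of square one, and fixed by `Cl(-Id) ∘ ψ` (`Cl.vol_isOddSymmetry`, `Cl.vol_fixed`).
Therefore every character `χ` of `s` gives a fixed graded *-homomorphism that sends `f` to `χ(f) •
1` for even `f` and to `χ(f) • ω` for odd `f`. The characters, the zero one included, are the
evaluations at the points of `ℝ ∪ {∞}` (`evalAt_surjective`). The point `0` yields `η(0)`, the point
`∞` yields the zero homomorphism, and `ℝ ∪ {∞}` is path connected (`EqMap.cls_η₀_eq_zero`).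

The same family exhausts the fixed points. If `h` is fixed, then each value `h(f)` is fixed by the
`ℂ`-linear anti-automorphism `Cl(-Id) ∘ ψ ∘ (-)*`, which multiplies a product of `k` distinct basis
vectors by `(-1)^(k(k+1)/2)`. Of `k = 0, 1, 2, 3` only `0` and `3` survive, so `h` takes values in
the span of `1` and `ω` (`Cl.eq_of_fixed`) and comes from a character
(`IsOddSymmetry.exists_hom_eq`). The resulting continuous bijection from the circle `ℝ ∪ {∞}` to the
Hausdorff space of fixed points is a homeomorphism. -/

/-! ### Characters of `C₀(ℝ, ℂ)` -/

/-- The evaluation of functions in `C₀(ℝ, ℂ)` at a point of the one-point compactification, where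
functions vanish at infinity. -/
def evalAt (t : OnePoint ℝ) : C₀(ℝ, ℂ) →⋆ₙₐ[ℂ] ℂ where
  toFun f := t.elim 0 f
  map_smul' z f := by cases t <;> simp
  map_zero' := by cases t <;> simp
  map_add' f g := by cases t <;> simp
  map_mul' f g := by cases t <;> simp
  map_star' f := by cases t <;> simp

@[simp] lemma evalAt_infty (f : C₀(ℝ, ℂ)) : evalAt OnePoint.infty f = 0 := rfl

@[simp] lemma evalAt_coe (t : ℝ) (f : C₀(ℝ, ℂ)) : evalAt (t : OnePoint ℝ) f = f t := rfl

/-- Continuity at the added point is exactly vanishing at infinity. -/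
lemma continuous_evalAt (f : C₀(ℝ, ℂ)) : Continuous fun t => evalAt t f := by
  rw [OnePoint.continuous_iff]
  refine ⟨?_, f.continuous⟩
  rw [Filter.coclosedCompact_eq_cocompact]
  exact f.zero_at_infty'

/-- The function `F - F(∞)` in `C₀(ℝ, ℂ)` for a continuous function `F` on the one-point
compactification of `ℝ`. -/
def subInfty (F : C(OnePoint ℝ, ℂ)) : C₀(ℝ, ℂ) where
  toFun x := F (x : OnePoint ℝ) - F OnePoint.infty
  continuous_toFun := (F.continuous.comp OnePoint.continuous_coe).sub continuous_const
  zero_at_infty' := by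
    have h := (OnePoint.continuous_iff _).1 F.continuous
    rw [Filter.coclosedCompact_eq_cocompact] at h
    simpa using h.1.sub_const (F OnePoint.infty)

@[simp] lemma subInfty_apply (F : C(OnePoint ℝ, ℂ)) (x : ℝ) :
    subInfty F x = F (x : OnePoint ℝ) - F OnePoint.infty := rfl

lemma evalAt_subInfty (t : OnePoint ℝ) (F : C(OnePoint ℝ, ℂ)) :
    evalAt t (subInfty F) = F t - F OnePoint.infty := by
  induction t using OnePoint.rec with
  | infty => simp
  | coe x => rfl

/-- Continuous functions separate the points of the compact Hausdorff space `OnePoint ℝ`, and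
subtracting the constant `F(∞)` does not affect separation. -/
lemma evalAt_injective : Function.Injective evalAt := by
  intro s t h
  refine (WeakDual.CharacterSpace.continuousMapEval_bijective (OnePoint ℝ) ℂ).1 (DFunLike.ext _ _ fun F => ?_)
  have := DFunLike.congr_fun h (subInfty F)
  rw [evalAt_subInfty, evalAt_subInfty, sub_left_inj] at this
  exact this

/-- The unital extension of a character of `C₀(ℝ, ℂ)` to the continuous functions on the one-point
compactification of `ℝ`. -/
def unitalExtension (χ : C₀(ℝ, ℂ) →⋆ₙₐ[ℂ] ℂ) : C(OnePoint ℝ, ℂ) →ₐ[ℂ] ℂ :=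
  AlgHom.ofLinearMap
    { toFun := fun F => F OnePoint.infty + χ (subInfty F)
      map_add' := fun F G => by
        have : subInfty (F + G) = subInfty F + subInfty G := by ext x; simp; ring
        rw [this, map_add, ContinuousMap.add_apply]; ring
      map_smul' := fun z F => by
        have : subInfty (z • F) = z • subInfty F := by ext x; simp; ring
        rw [this, map_smul, ContinuousMap.smul_apply, RingHom.id_apply, smul_add] }
    (by
      have : subInfty 1 = 0 := by ext x; simp
      simp [this])
    (fun F G => by
      -- Expand the product of `F = F(∞) + subInfty F` and `G = G(∞) + subInfty G`, and drop the
      -- constant term.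
      have : subInfty (F * G) = subInfty F * subInfty G + F OnePoint.infty • subInfty G +
          G OnePoint.infty • subInfty F := by ext x; simp; ring
      simp only [LinearMap.coe_mk, AddHom.coe_mk, this, map_add, map_mul, map_smul, smul_eq_mul,
        ContinuousMap.mul_apply]
      ring)

lemma unitalExtension_apply (χ : C₀(ℝ, ℂ) →⋆ₙₐ[ℂ] ℂ) (F : C(OnePoint ℝ, ℂ)) :
    unitalExtension χ F = F OnePoint.infty + χ (subInfty F) := rfl

/-- Every character of `C₀(ℝ, ℂ)` is the evaluation at a point of the one-point compactification. -/
lemma evalAt_surjective : Function.Surjective evalAt := by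
  intro χ
  -- Gelfand duality for a compact space. The extension is unital, hence a nonzero character even
  -- when `χ = 0`; that case corresponds to `t = ∞`.
  obtain ⟨t, ht⟩ := (WeakDual.CharacterSpace.continuousMapEval_bijective (OnePoint ℝ) ℂ).2
    (WeakDual.CharacterSpace.equivAlgHom.symm (unitalExtension χ))
  refine ⟨t, DFunLike.ext _ _ fun f => ?_⟩
  -- The extension of `f` by the value `0` at infinity, on which the unital extension agrees with `χ
  -- f`.
  let F : C(OnePoint ℝ, ℂ) := ⟨fun t => evalAt t f, continuous_evalAt f⟩
  have hF : subInfty F = f := by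
    ext x
    exact sub_zero _
  have h := DFunLike.congr_fun ht F
  have h2 : unitalExtension χ F = χ f := by
    rw [unitalExtension_apply, hF]
    exact zero_add _
  exact h.trans h2

/-- Stereographic projection, followed by the isometry of the Euclidean plane with `ℂ`. -/
lemma nonempty_onePoint_real_homeomorph_circle : Nonempty (OnePoint ℝ ≃ₜ Circle) := by
  have e : OnePoint ℝ ≃ₜ Metric.sphere (0 : EuclideanSpace ℝ (Fin 2)) 1 :=
    onePointEquivSphereOfFinrankEq (by simp)
  let φ : EuclideanSpace ℝ (Fin 2) ≃ₗᵢ[ℝ] ℂ := Complex.orthonormalBasisOneI.repr.symm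
  have e' : Metric.sphere (0 : EuclideanSpace ℝ (Fin 2)) 1 ≃ₜ Circle :=
    { toFun := fun z => ⟨φ z.1, mem_sphere_zero_iff_norm.2
        ((φ.norm_map _).trans (mem_sphere_zero_iff_norm.1 z.2))⟩
      invFun := fun z => ⟨φ.symm z.1, mem_sphere_zero_iff_norm.2
        ((φ.symm.norm_map _).trans z.norm_coe)⟩
      left_inv := fun z => Subtype.ext (φ.symm_apply_apply _)
      right_inv := fun z => Subtype.ext (φ.apply_symm_apply _)
      continuous_toFun := (φ.continuous.comp continuous_subtype_val).subtype_mk _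
      continuous_invFun := (φ.symm.continuous.comp continuous_subtype_val).subtype_mk _ }
  exact ⟨e.trans e'⟩

/-- The circle is the continuous image of `ℝ` under the exponential. A path from `0` to `∞` is what
later becomes the nullhomotopy. -/
instance : PathConnectedSpace (OnePoint ℝ) := by
  obtain ⟨e⟩ := nonempty_onePoint_real_homeomorph_circle
  exact (e.symm.surjective.comp Circle.exp_surjective).pathConnectedSpace
    (e.symm.continuous.comp Circle.exp.continuous)

/-! ### Graded homomorphisms determined by a character and an odd symmetry -/

lemma sGrading_sGrading (f : C₀(ℝ, ℂ)) : sGrading (sGrading f) = f := by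
  ext x
  simp

/-- An odd self-adjoint element `ω` of square one. -/
structure IsOddSymmetry {V : CRep} (ω : Cl V) : Prop where
  mul_self : ω * ω = 1
  star_eq : star ω = ω
  α_eq : Cl.α ω = -ω

section TwistedCharacter

variable {V : CRep} {ω : Cl V}

/-- For a character `χ` of `s` and an odd symmetry `ω`, the graded *-homomorphism that sends `f` to
`χ(f) • 1` for even `f` and to `χ(f) • ω` for odd `f`. -/
def IsOddSymmetry.hom (hω : IsOddSymmetry ω) (χ : C₀(ℝ, ℂ) →⋆ₙₐ[ℂ] ℂ) : CstarGr (Cl V) Cl.α := ⟨{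
  toFun := fun f => ((χ f + χ (sGrading f)) / 2) • (1 : Cl V) + ((χ f - χ (sGrading f)) / 2) • ω
  map_smul' := fun z f => by
    have : sGrading (z • f) = z • sGrading f := rfl
    simp only [this, map_smul, smul_eq_mul, MonoidHom.id_apply]
    module
  map_zero' := by
    have : sGrading 0 = 0 := rfl
    simp [this]
  map_add' := fun f g => by
    have : sGrading (f + g) = sGrading f + sGrading g := rfl
    simp only [this, map_add]
    module
  map_mul' := fun f g => by
    have : sGrading (f * g) = sGrading f * sGrading g := rfl
    simp only [this, map_mul, mul_add, add_mul, smul_mul_smul_comm, one_mul, mul_one, hω.mul_self]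
    module
  map_star' := fun f => by
    have : sGrading (star f) = star (sGrading f) := rfl
    simp only [this, map_star, star_add, star_smul, star_one, hω.star_eq, RCLike.star_def, map_div₀,
      map_add, map_sub, map_ofNat] }, fun f => by
  simp only [NonUnitalStarAlgHom.coe_mk', NonUnitalAlgHom.coe_mk, sGrading_sGrading, map_add,
    map_smul, map_one, hω.α_eq]
  module⟩

lemma IsOddSymmetry.hom_apply (hω : IsOddSymmetry ω) (χ : C₀(ℝ, ℂ) →⋆ₙₐ[ℂ] ℂ) (f : C₀(ℝ, ℂ)) :
    (hω.hom χ).1 f =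
      ((χ f + χ (sGrading f)) / 2) • (1 : Cl V) + ((χ f - χ (sGrading f)) / 2) • ω := rfl

/-- The Clifford algebra is linearly isomorphic to the exterior algebra, and base change from `ℝ` to
`ℂ` is faithful. -/
instance : Nontrivial (Cl V) := by
  have : Nontrivial (CliffordAlgebra (normSqForm V)) :=
    (CliffordAlgebra.equivExterior (normSqForm V)).toEquiv.nontrivial
  exact inferInstanceAs (Nontrivial (ℂ ⊗[ℝ] CliffordAlgebra (normSqForm V)))

/-- The summands have different degrees: applying the grading gives `1 - ω = 0` as well, and the sum
of the two equations is `2 = 0`. -/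
lemma IsOddSymmetry.one_add_ne_zero (hω : IsOddSymmetry ω) : 1 + ω ≠ 0 := by
  intro h
  have h2 := congrArg Cl.α h
  rw [map_add, map_one, hω.α_eq, map_zero] at h2
  have h3 : (2 : ℂ) • (1 : Cl V) = 0 := by
    calc (2 : ℂ) • (1 : Cl V) = (1 + ω) + (1 + -ω) := by module
      _ = 0 := by rw [h, h2, add_zero]
  exact one_ne_zero ((smul_eq_zero.1 h3).resolve_left two_ne_zero)

/-- Since `ω (1 + ω) = 1 + ω`, an element `a + bω` acts on `1 + ω` as the scalar `a + b`; here the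
even and odd contributions add up to `χ f`. The character is thus recovered as an eigenvalue. -/
lemma IsOddSymmetry.hom_mul (hω : IsOddSymmetry ω) (χ : C₀(ℝ, ℂ) →⋆ₙₐ[ℂ] ℂ) (f : C₀(ℝ, ℂ)) :
    (hω.hom χ).1 f * (1 + ω) = χ f • (1 + ω) := by
  rw [hω.hom_apply]
  simp only [mul_add, add_mul, smul_mul_assoc, one_mul, mul_one, hω.mul_self]
  module

lemma IsOddSymmetry.hom_injective (hω : IsOddSymmetry ω) : Function.Injective hω.hom := by
  intro χ χ' h
  refine DFunLike.ext _ _ fun f => ?_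
  have := hω.hom_mul χ f
  rw [h, hω.hom_mul] at this
  exact (smul_left_injective ℂ hω.one_add_ne_zero this).symm

/-- A graded *-homomorphism with values in the span of `1` and `ω` comes from a character. -/
lemma IsOddSymmetry.exists_hom_eq (hω : IsOddSymmetry ω) (h : CstarGr (Cl V) Cl.α)
    (hh : ∀ f, ∃ a b : ℂ, h.1 f = a • (1 : Cl V) + b • ω) : ∃ χ, hω.hom χ = h := by
  -- The eigenvalue on `1 + ω` defines the character. The version with `1 + ω` on the left is needed
  -- only for compatibility with the star, which reverses products.
  have key : ∀ f, ∃ c : ℂ, h.1 f * (1 + ω) = c • (1 + ω) ∧ (1 + ω) * h.1 f = c • (1 + ω) := by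
    intro f
    obtain ⟨a, b, hf⟩ := hh f
    refine ⟨a + b, ?_, ?_⟩ <;>
    · rw [hf]
      simp only [mul_add, add_mul, smul_mul_assoc, mul_smul_comm, one_mul, mul_one, hω.mul_self]
      module
  choose χ hl hr using key
  have inj : Function.Injective fun c : ℂ => c • (1 + ω) :=
    smul_left_injective ℂ hω.one_add_ne_zero
  have hs : star (1 + ω) = 1 + ω := by rw [star_add, star_one, hω.star_eq]
  let χ' : C₀(ℝ, ℂ) →⋆ₙₐ[ℂ] ℂ :=
    { toFun := χ
      map_smul' := fun z f => inj (by
        change χ (z • f) • (1 + ω) = (z • χ f) • (1 + ω)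
        rw [← hl, map_smul, smul_mul_assoc, hl, smul_assoc])
      map_zero' := inj (by
        change χ 0 • (1 + ω) = (0 : ℂ) • (1 + ω)
        rw [← hl, map_zero, zero_mul, zero_smul])
      map_add' := fun f g => inj (by
        change χ (f + g) • (1 + ω) = (χ f + χ g) • (1 + ω)
        rw [← hl, map_add, add_mul, hl, hl, add_smul])
      map_mul' := fun f g => inj (by
        change χ (f * g) • (1 + ω) = (χ f * χ g) • (1 + ω)
        rw [← hl, map_mul, mul_assoc, hl, mul_smul_comm, hl, smul_smul, mul_comm])
      map_star' := fun f => inj (by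
        change χ (star f) • (1 + ω) = star (χ f) • (1 + ω)
        rw [← hl, map_star]
        nth_rw 1 [← hs]
        rw [← star_mul, hr, star_smul, hs]) }
  refine ⟨χ', Subtype.ext (DFunLike.ext _ _ fun f => ?_)⟩
  obtain ⟨a, b, hf⟩ := hh f
  have h1 : χ f = a + b := inj (by
    change χ f • (1 + ω) = (a + b) • (1 + ω)
    rw [← hl, hf]
    simp only [mul_add, add_mul, smul_mul_assoc, one_mul, mul_one, hω.mul_self]
    module)
  -- As `h` is graded and `ω` is odd, the grading changes the sign of `b`. Half the sum and half the
  -- difference of the two values then return `a` and `b`.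
  have h2 : χ (sGrading f) = a - b := inj (by
    change χ (sGrading f) • (1 + ω) = (a - b) • (1 + ω)
    rw [← hl, h.2, hf, map_add, map_smul, map_smul, map_one, hω.α_eq]
    simp only [mul_add, add_mul, smul_mul_assoc, one_mul, mul_one, hω.mul_self, neg_mul, smul_neg]
    module)
  rw [hω.hom_apply, hf]
  change ((χ f + χ (sGrading f)) / 2) • (1 : Cl V) + ((χ f - χ (sGrading f)) / 2) • ω = _
  rw [h1, h2]
  module

/-! ### Topology of the Clifford algebra and of the space of homomorphisms -/

lemma continuous_Cl_iff {X : Type*} [TopologicalSpace X] {g : X → Cl V} :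
    Continuous g ↔ ∀ l : Module.Dual ℂ (Cl V), Continuous fun x => l (g x) := by
  simp only [continuous_iInf_rng, continuous_induced_rng, Function.comp_def]

/-- Linear functionals separate the points of a vector space. Hausdorffness passes to homomorphism
spaces, where it makes a continuous bijection from a compact space a homeomorphism. -/
instance : T2Space (Cl V) := by
  refine ⟨fun x y hxy => ?_⟩
  obtain ⟨l, hl⟩ : ∃ l : Module.Dual ℂ (Cl V), l x ≠ l y := by
    by_contra! h
    exact hxy (sub_eq_zero.1 ((Module.forall_dual_apply_eq_zero_iff ℂ (x - y)).1 fun l => by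
      rw [map_sub, h, sub_self]))
  exact separated_by_continuous (continuous_Cl_iff.1 continuous_id l) hl

instance {A : Type*} [NonUnitalNonAssocSemiring A] [Module ℂ A] [Star A] [TopologicalSpace A]
    [T2Space A] (α : A → A) : T2Space (CstarGr A α) :=
  T2Space.of_injective_continuous (f := fun (h : CstarGr A α) (f : C₀(ℝ, ℂ)) => h.1 f)
    (fun _ _ h => Subtype.ext (DFunLike.coe_injective h)) continuous_induced_dom

lemma IsOddSymmetry.continuous_hom_evalAt (hω : IsOddSymmetry ω) :
    Continuous fun t => hω.hom (evalAt t) := by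
  refine continuous_induced_rng.2 (continuous_pi fun f => continuous_Cl_iff.2 fun l => ?_)
  simp only [Function.comp_apply, hω.hom_apply, map_add, map_smul, smul_eq_mul]
  have h1 := continuous_evalAt f
  have h2 := continuous_evalAt (sGrading f)
  fun_prop

/-- If `ω` is fixed by `Cl(τ) ∘ ψ`, then so are the homomorphisms defined by `ω`. -/
lemma IsOddSymmetry.hom_fixed (hω : IsOddSymmetry ω)
    (hf : Cl.map V.τ.toLinearIsometry (Cl.ψ ω) = ω) (χ : C₀(ℝ, ℂ) →⋆ₙₐ[ℂ] ℂ) (f : C₀(ℝ, ℂ)) :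
    (hω.hom χ).1 f = Cl.map V.τ.toLinearIsometry (Cl.ψ ((hω.hom χ).1 (star f))) := by
  have h : sGrading (star f) = star (sGrading f) := rfl
  have h1 : Cl.ψ (1 : Cl V) = 1 := map_one Cl.ψHom
  simp only [hω.hom_apply, h, map_star, map_add, map_smulₛₗ, h1, map_one, hf, map_div₀, map_sub,
    RCLike.star_def, Complex.conj_conj, map_ofNat, RingHom.id_apply]

/-- The hypothesis `hspan` says that there is no room for fixed homomorphisms other than those
attached to characters, so that the fixed points are parametrized by the character space with the
zero character added. -/
lemma IsOddSymmetry.homeomorph_fixedPoints (hω : IsOddSymmetry ω)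
    (hf : Cl.map V.τ.toLinearIsometry (Cl.ψ ω) = ω)
    (hspan : ∀ x : Cl V, Cl.map V.τ.toLinearIsometry (Cl.ψ (star x)) = x →
      ∃ a b : ℂ, x = a • (1 : Cl V) + b • ω) :
    Nonempty (FixedPoints V ≃ₜ OnePoint ℝ) := by
  let g : OnePoint ℝ → FixedPoints V := fun t => ⟨hω.hom (evalAt t), hω.hom_fixed hf _⟩
  have hg : Function.Bijective g := by
    refine ⟨fun s t h => evalAt_injective (hω.hom_injective (congrArg Subtype.val h)), fun h => ?_⟩
    -- Because `h (star f) = star (h f)`, the fixed point equation for `h` becomes a condition on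
    -- each single value `h f`.
    obtain ⟨χ, hχ⟩ := hω.exists_hom_eq h.1 fun f => hspan _ (by
      rw [← map_star]
      exact (h.2 f).symm)
    obtain ⟨t, rfl⟩ := evalAt_surjective χ
    exact ⟨t, Subtype.ext hχ⟩
  exact ⟨(Continuous.homeoOfEquivCompactToT2 (f := Equiv.ofBijective g hg)
    (hω.continuous_hom_evalAt.subtype_mk _)).symm⟩

end TwistedCharacter

/-! ### The volume element of three orthonormal vectors -/

section Volume

variable {V : CRep}

lemma Cl.ι_add (x y : V) : Cl.ι (x + y) = Cl.ι x + Cl.ι y := by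
  rw [Cl.ι, map_add]
  exact TensorProduct.tmul_add _ _ _

lemma Cl.ι_smul (r : ℝ) (x : V) : Cl.ι (r • x) = (r : ℂ) • Cl.ι x := by
  rw [Cl.ι, Cl.ι, map_smul, Cl.smul_mk, mul_one]
  refine (TensorProduct.smul_tmul (R := ℝ) r (1 : ℂ) _).symm.trans ?_
  rw [Complex.real_smul, mul_one]
  rfl

lemma Cl.ι_neg (x : V) : Cl.ι (-x) = -Cl.ι x := by
  simpa using Cl.ι_smul (-1) x

/-- Polarization: compare `[x + y]² = |x + y|²` with `[x]² + [y]² = |x|² + |y|²`, using the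
Pythagorean theorem. -/
lemma Cl.ι_mul_ι_swap {x y : V} (h : ⟪x, y⟫_ℝ = 0) : Cl.ι y * Cl.ι x = -(Cl.ι x * Cl.ι y) := by
  have h1 := Cl.ι_mul_self (x + y)
  rw [Cl.ι_add, norm_add_sq_real, h, mul_zero, add_zero, Complex.ofReal_add, add_smul,
    ← Cl.ι_mul_self, ← Cl.ι_mul_self, mul_add, add_mul, add_mul, add_assoc, add_right_inj,
    ← add_assoc, add_eq_right] at h1
  exact eq_neg_of_add_eq_zero_left h1

lemma Cl.ψ_one : Cl.ψ (1 : Cl V) = 1 := map_one Cl.ψHom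

variable {v : Fin 3 → V}

lemma Cl.ι_orthonormal_sq (hv : Orthonormal ℝ v) (i : Fin 3) : Cl.ι (v i) * Cl.ι (v i) = 1 := by
  rw [Cl.ι_mul_self, hv.1 i]
  simp

/-- The variants with a trailing factor `x` apply inside words that are bracketed to the right. -/
lemma Cl.ι_orthonormal_sq_mul (hv : Orthonormal ℝ v) (i : Fin 3) (x : Cl V) :
    Cl.ι (v i) * (Cl.ι (v i) * x) = x := by
  rw [← mul_assoc, Cl.ι_orthonormal_sq hv, one_mul]

/-- As a rewriting rule it is applied only with `i < j`; it then sorts the indices of a word in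
increasing order and terminates. -/
lemma Cl.ι_orthonormal_swap (hv : Orthonormal ℝ v) {i j : Fin 3} (hij : i ≠ j) :
    Cl.ι (v j) * Cl.ι (v i) = -(Cl.ι (v i) * Cl.ι (v j)) :=
  Cl.ι_mul_ι_swap (hv.2 hij)

lemma Cl.ι_orthonormal_swap_mul (hv : Orthonormal ℝ v) {i j : Fin 3} (hij : i ≠ j) (x : Cl V) :
    Cl.ι (v j) * (Cl.ι (v i) * x) = -(Cl.ι (v i) * (Cl.ι (v j) * x)) := by
  rw [← mul_assoc, Cl.ι_orthonormal_swap hv hij, neg_mul, mul_assoc]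

/-- The element `i [v₀] [v₁] [v₂]` of the Clifford algebra. -/
def Cl.vol (v : Fin 3 → V) : Cl V := Complex.I • (Cl.ι (v 0) * (Cl.ι (v 1) * Cl.ι (v 2)))

/-- The word `[v₀][v₁][v₂]` has square `-1` and changes sign under reversal. The factor `i` corrects
both signs, since `i² = -1` and `conj i = -i`. Oddness holds because the word has length three. -/
lemma Cl.vol_isOddSymmetry (hv : Orthonormal ℝ v) : IsOddSymmetry (Cl.vol v) := by
  have h01 : (0 : Fin 3) ≠ 1 := by decide
  have h02 : (0 : Fin 3) ≠ 2 := by decide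
  have h12 : (1 : Fin 3) ≠ 2 := by decide
  refine ⟨?_, ?_, ?_⟩
  · simp only [Cl.vol, smul_mul_smul_comm, mul_assoc, Cl.ι_orthonormal_sq_mul hv,
      Cl.ι_orthonormal_sq hv, Cl.ι_orthonormal_swap_mul hv h01, Cl.ι_orthonormal_swap_mul hv h02,
      Cl.ι_orthonormal_swap_mul hv h12, mul_neg, neg_neg, Complex.I_mul_I, neg_smul, smul_neg,
      one_smul]
  · simp only [Cl.vol, star_smul, star_mul, Cl.star_ι, mul_assoc, neg_mul,
      Cl.ι_orthonormal_swap hv h02, Cl.ι_orthonormal_swap hv h12,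
      Cl.ι_orthonormal_swap_mul hv h01, mul_neg, neg_neg, RCLike.star_def, Complex.conj_I, neg_smul,
      smul_neg]
  · simp only [Cl.vol, map_smul, map_mul, Cl.α_ι, mul_neg, neg_mul, neg_neg, smul_neg]

/-- Two signs cancel: `ψ` conjugates the factor `i`, and `τ` contributes `(-1)³`. -/
lemma Cl.vol_fixed (hτ : ∀ i, V.τ (v i) = -v i) :
    Cl.map V.τ.toLinearIsometry (Cl.ψ (Cl.vol v)) = Cl.vol v := by
  simp only [Cl.vol, map_smulₛₗ, Cl.ψ_mul, Cl.ψ_ι, map_mul, Cl.map_ι,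
    LinearIsometryEquiv.coe_toLinearIsometry, hτ, Cl.ι_neg, mul_neg, neg_mul, neg_neg, smul_neg,
    Complex.conj_I, RingHom.id_apply, neg_smul, map_neg]

/-- The products of distinct basis vectors span the Clifford algebra. -/
lemma Cl.exists_coordinates (b : OrthonormalBasis (Fin 3) ℝ V) (x : Cl V) :
    ∃ c : Fin 8 → ℂ, x = c 0 • 1 + c 1 • Cl.ι (b 0) + c 2 • Cl.ι (b 1) + c 3 • Cl.ι (b 2) +
      c 4 • (Cl.ι (b 0) * Cl.ι (b 1)) + c 5 • (Cl.ι (b 0) * Cl.ι (b 2)) +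
      c 6 • (Cl.ι (b 1) * Cl.ι (b 2)) + c 7 • (Cl.ι (b 0) * (Cl.ι (b 1) * Cl.ι (b 2))) := by
  have hv := b.orthonormal
  have h01 : (0 : Fin 3) ≠ 1 := by decide
  have h02 : (0 : Fin 3) ≠ 2 := by decide
  have h12 : (1 : Fin 3) ≠ 2 := by decide
  -- The span contains `1`, so it is everything as soon as it is closed under sums, scalars and left
  -- multiplication by the generators.
  let P : Cl V → Prop := fun x => ∃ c : Fin 8 → ℂ, x = c 0 • 1 + c 1 • Cl.ι (b 0) +
    c 2 • Cl.ι (b 1) + c 3 • Cl.ι (b 2) +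
      c 4 • (Cl.ι (b 0) * Cl.ι (b 1)) + c 5 • (Cl.ι (b 0) * Cl.ι (b 2)) +
      c 6 • (Cl.ι (b 1) * Cl.ι (b 2)) + c 7 • (Cl.ι (b 0) * (Cl.ι (b 1) * Cl.ι (b 2)))
  have hadd : ∀ x y, P x → P y → P (x + y) := by
    rintro _ _ ⟨c, rfl⟩ ⟨d, rfl⟩
    exact ⟨c + d, by simp only [Pi.add_apply]; module⟩
  have hsmul : ∀ (z : ℂ) x, P x → P (z • x) := by
    rintro z _ ⟨c, rfl⟩
    exact ⟨z • c, by simp only [Pi.smul_apply, smul_eq_mul]; module⟩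
  have hb : ∀ i x, P x → P (Cl.ι (b i) * x) := by
    rintro i _ ⟨c, rfl⟩
    simp only [mul_add, mul_smul_comm, mul_one]
    fin_cases i
    -- In each of the three cases the witness lists the coordinates of `[bᵢ] x` in the basis `1,
    -- [b₀], [b₁], [b₂], [b₀][b₁], [b₀][b₂], [b₁][b₂], [b₀][b₁][b₂]`. Signs arise from moving `[bᵢ]`
    -- past vectors of smaller index.
    · refine ⟨![c 1, c 0, c 4, c 5, c 2, c 3, c 7, c 6], ?_⟩
      simp [Cl.ι_orthonormal_sq_mul hv, Cl.ι_orthonormal_sq hv]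
      module
    · refine ⟨![c 2, -c 4, c 0, c 6, -c 1, -c 7, c 3, -c 5], ?_⟩
      simp [Cl.ι_orthonormal_sq_mul hv, Cl.ι_orthonormal_sq hv, Cl.ι_orthonormal_swap hv h01,
        Cl.ι_orthonormal_swap_mul hv h01]
      module
    · refine ⟨![c 3, -c 5, -c 6, c 0, c 7, -c 1, -c 2, c 4], ?_⟩
      simp [Cl.ι_orthonormal_sq hv, Cl.ι_orthonormal_swap hv h02,
        Cl.ι_orthonormal_swap_mul hv h02, Cl.ι_orthonormal_swap hv h12,
        Cl.ι_orthonormal_swap_mul hv h12]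
      module
  have hι : ∀ w x, P x → P (Cl.ι w * x) := by
    intro w x hx
    have hw : Cl.ι w = ∑ i, ((b.repr w i : ℝ) : ℂ) • Cl.ι (b i) := by
      conv_lhs => rw [← b.sum_repr w]
      simp only [Fin.sum_univ_three, Cl.ι_add, Cl.ι_smul]
    rw [hw, Fin.sum_univ_three]
    simp only [add_mul, smul_mul_assoc]
    exact hadd _ _ (hadd _ _ (hsmul _ _ (hb _ _ hx)) (hsmul _ _ (hb _ _ hx)))
      (hsmul _ _ (hb _ _ hx))
  have h1 : P 1 := ⟨![1, 0, 0, 0, 0, 0, 0, 0], by simp⟩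
  change P x
  induction x using Cl.induction with
  | h0 => simpa using hsmul 0 _ h1
  | h2 x y hx hy => exact hadd _ _ hx hy
  | h1 z c =>
    rw [← mul_one z, ← Cl.smul_mk]
    refine hsmul _ _ ?_
    induction c using CliffordAlgebra.left_induction with
    | algebraMap r =>
      rw [Algebra.algebraMap_eq_smul_one]
      have : Cl.mk 1 (r • (1 : CliffordAlgebra (normSqForm V))) = (r : ℂ) • (1 : Cl V) := by
        rw [Cl.one_def, Cl.smul_mk, mul_one]
        refine (TensorProduct.smul_tmul (R := ℝ) r (1 : ℂ) _).symm.trans ?_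
        rw [Complex.real_smul, mul_one]
        rfl
      rw [this]
      exact hsmul _ _ h1
    | add c d hc hd =>
      have : Cl.mk 1 (c + d) = Cl.mk 1 c + Cl.mk 1 d := TensorProduct.tmul_add _ _ _
      rw [this]
      exact hadd _ _ hc hd
    | ι_mul c w hc =>
      have : Cl.mk 1 (CliffordAlgebra.ι (normSqForm V) w * c) = Cl.ι w * Cl.mk 1 c := by
        rw [Cl.ι, Cl.mk_mul_mk, mul_one]
      rw [this]
      exact hι _ _ hc

/-- For three copies of the sign representation, the elements fixed by the `ℂ`-linear
anti-automorphism `Cl(τ) ∘ ψ ∘ (-)*` are the linear combinations of `1` and the volume element. -/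
lemma Cl.eq_of_fixed (b : OrthonormalBasis (Fin 3) ℝ V) (hτ : ∀ i, V.τ (b i) = -b i) (x : Cl V)
    (hx : Cl.map V.τ.toLinearIsometry (Cl.ψ (star x)) = x) :
    ∃ a d : ℂ, x = a • (1 : Cl V) + d • Cl.vol b := by
  have hv := b.orthonormal
  have h01 : (0 : Fin 3) ≠ 1 := by decide
  have h02 : (0 : Fin 3) ≠ 2 := by decide
  have h12 : (1 : Fin 3) ≠ 2 := by decide
  obtain ⟨c, hc⟩ := Cl.exists_coordinates b x
  -- The scalar `-i` undoes the factor `i` in `Cl.vol`.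
  refine ⟨c 0, -Complex.I * c 7, ?_⟩
  -- Averaging `x` with its image cancels the six terms of word length one and two, on which the
  -- anti-automorphism is `-1`. No coefficients are compared, so linear independence of the eight
  -- words is not needed.
  have h2 : x = (1 / 2 : ℂ) • (x + Cl.map V.τ.toLinearIsometry (Cl.ψ (star x))) := by
    rw [hx]; module
  rw [hc] at h2
  simp only [star_add, star_smul, star_one, star_mul, Cl.star_ι, map_add, map_smulₛₗ, Cl.ψ_mul,
    Cl.ψ_ι, Cl.ψ_one, map_one, map_mul, Cl.map_ι, LinearIsometryEquiv.coe_toLinearIsometry, hτ,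
    Cl.ι_neg, mul_neg, neg_mul, neg_neg, RCLike.star_def, Complex.conj_conj, RingHom.id_apply,
    map_neg, mul_assoc, Cl.ι_orthonormal_swap hv h01,
    Cl.ι_orthonormal_swap hv h02, Cl.ι_orthonormal_swap hv h12, Cl.ι_orthonormal_swap_mul hv h01]
    at h2
  rw [hc, h2, Cl.vol, smul_smul, mul_right_comm, neg_mul, Complex.I_mul_I]
  module

end Volume

/-! ### The fixed points for three copies of the sign representation -/

/-- Three copies of the sign representation. -/
abbrev CRep.sign₃ : CRep := CRep.sum (CRep.sum CRep.sign CRep.sign) CRep.sign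

lemma CRep.finrank_sum (V W : CRep) :
    Module.finrank ℝ (CRep.sum V W) = Module.finrank ℝ V + Module.finrank ℝ W :=
  (WithLp.linearEquiv 2 ℝ (V × W)).finrank_eq.trans Module.finrank_prod

lemma CRep.sign₃_τ (x : CRep.sign₃) : CRep.sign₃.τ x = -x := rfl

/-- An orthonormal basis of three copies of the sign representation. -/
def CRep.sign₃Basis : OrthonormalBasis (Fin 3) ℝ CRep.sign₃ :=
  (stdOrthonormalBasis ℝ CRep.sign₃).reindex (finCongr (by
    have h : Module.finrank ℝ CRep.sign = 1 := Module.finrank_self ℝ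
    rw [CRep.finrank_sum, CRep.finrank_sum, h]))

lemma fixedPoints_homeomorph_circle : Nonempty (FixedPoints CRep.sign₃ ≃ₜ Circle) := by
  have hω := Cl.vol_isOddSymmetry CRep.sign₃Basis.orthonormal
  obtain ⟨e⟩ := hω.homeomorph_fixedPoints (Cl.vol_fixed fun i => CRep.sign₃_τ _)
    (Cl.eq_of_fixed CRep.sign₃Basis fun i => CRep.sign₃_τ _)
  obtain ⟨e'⟩ := nonempty_onePoint_real_homeomorph_circle
  exact ⟨e.trans e'⟩

/-! ### Points of `KR(V)` that come from the Clifford algebra -/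

section Unit

variable {V W : Type} [NormedAddCommGroup V] [InnerProductSpace ℝ V] [FiniteDimensional ℝ V]
  [NormedAddCommGroup W] [InnerProductSpace ℝ W] [FiniteDimensional ℝ W]

/-- The induced unitary preserves the vacuum vector, and therefore the projection onto its line. In
contrast to `KOp.map_p₀`, source and target may differ, as is needed for the isometry that
interchanges summands. -/
lemma KOp.map_p₀_eq (φ : V ≃ₗᵢ[ℝ] W) : KOp.map φ (KOp.p₀ : KOp V) = KOp.p₀ := by
  refine KOp.ext' fun x => ?_
  rw [KOp.map_apply, KOp.p₀, KOp.op_of, InnerProductSpace.rankOne_apply, KOp.p₀, KOp.op_of,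
    InnerProductSpace.rankOne_apply, map_smul, Fock.map_vac]
  congr 1
  rw [← LinearIsometryEquiv.inner_map_map (Fock.map φ), Fock.map_vac,
    LinearIsometryEquiv.apply_symm_apply]

/-- A tensor product of rank one operators has rank one, and the product of the two vacuum vectors
is the vacuum vector. -/
lemma KOp.mul_p₀_p₀ : KOp.mul (KOp.p₀ : KOp V) (KOp.p₀ : KOp W) = KOp.p₀ := by
  have h : Fock.tensor ((Fock.vac : Fock V) ⊗ₜ[ℂ] (Fock.vac : Fock W)) = Fock.vac := by
    rw [Fock.tensor_tmul, Fock.vac, Fock.vac, Fock.mul_coe, SymC.mul_apply, map_one, map_one,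
      mul_one, Fock.vac]
  refine Subtype.ext ((tensorOp_rankOne Fock.denseRange_tensor _ _ _ _).trans ?_)
  rw [h]
  rfl

lemma fc_zero_apply (f : C₀(ℝ, ℂ)) : (fc (0 : V)).1 f = f 0 • (1 : Cl V) := by
  change evenPart f ‖(0 : V)‖ • (1 : Cl V) + (oddPart f ‖(0 : V)‖ / ‖(0 : V)‖) • Cl.ι (0 : V) = _
  simp [evenPart, oddPart]

lemma KR.η_zero_apply (f : C₀(ℝ, ℂ)) :
    (KR.η ((0 : V) : OnePoint V)).1 f = KA.mk (f 0 • (1 : Cl V)) KOp.p₀ := by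
  change KA.mk ((fc (0 : V)).1 f) KOp.p₀ = _
  rw [fc_zero_apply]

/-- Only `1` and `p₀` enter `η(0)`, and both are natural. This absorbs the isometry in the
definition of the product. -/
lemma KR.map_η_zero (φ : V ≃ₗᵢ[ℝ] W) :
    KR.map φ (KR.η ((0 : V) : OnePoint V)) = KR.η ((0 : W) : OnePoint W) := by
  refine Subtype.ext (DFunLike.ext _ _ fun f => ?_)
  change KA.map φ ((KR.η ((0 : V) : OnePoint V)).1 f) = _
  rw [KR.η_zero_apply, KR.η_zero_apply, KA.map_mk, map_smul, map_one, KOp.map_p₀_eq]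

/-- Evaluation at `0` takes the values `1` on `u` and `0` on `v`, so the two conditions reduce to
`p₀ ⊗ p₀ = p₀` and `0 = 0 + 0`. -/
lemma isGradedProduct_η_zero : IsGradedProduct (KR.η ((0 : V) : OnePoint V))
    (KR.η ((0 : W) : OnePoint W)) (KR.η ((0 : OSum V W) : OnePoint (OSum V W))) := by
  have hu : uFun 0 = 1 := by simp [uFun]
  have hv : vFun 0 = 0 := by simp [vFun]
  constructor
  · simp only [KR.η_zero_apply, hu, one_smul, KA.mul_mk, KOp.mul_p₀_p₀, map_one, mul_one]
  · have h0 : KA.mk (0 : Cl (OSum V W)) KOp.p₀ = 0 := map_zero KA.mkP₀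
    simp only [KR.η_zero_apply, hu, hv, zero_smul, KA.mul_mk, KOp.mul_p₀_p₀, map_zero, mul_zero,
      zero_mul, h0, add_zero]

end Unit

section Points

variable {V : CRep}

/-- The map `C*_gr(s, Cl V) → KR(V)` induced by `- ⊗ p₀`. -/
def KR.ofCl (h : CstarGr (Cl V) Cl.α) : KR V :=
  ⟨KA.mkP₀.comp h.1, fun f => congrArg (fun c => KA.mk c KOp.p₀) (h.2 f)⟩

lemma KR.ofCl_apply (h : CstarGr (Cl V) Cl.α) (f : C₀(ℝ, ℂ)) :
    (KR.ofCl h).1 f = KA.mk (h.1 f) KOp.p₀ := rfl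

/-- The slice of `c ⊗ p₀` along a functional `l` is `l(c) • p₀`, which is continuous in `c`. -/
lemma KR.continuous_ofCl : Continuous (KR.ofCl (V := V)) := by
  refine continuous_induced_rng.2 (continuous_pi fun f => continuous_iInf_rng.2 fun l =>
    continuous_induced_rng.2 ?_)
  have h1 : Continuous fun h : CstarGr (Cl V) Cl.α => h.1 f :=
    (continuous_apply f).comp continuous_induced_dom
  exact (continuous_Cl_iff.1 h1 l).smul continuous_const

/-- Both conjugation and functoriality fix `p₀`, so the action only sees the Clifford factor. -/
lemma KR.act_ofCl {h : CstarGr (Cl V) Cl.α}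
    (hh : ∀ f, h.1 f = Cl.map V.τ.toLinearIsometry (Cl.ψ (h.1 (star f)))) :
    KR.act (KR.ofCl h) = KR.ofCl h := by
  refine Subtype.ext (DFunLike.ext _ _ fun f => ?_)
  change KA.map V.τ (KA.ψ (KA.mk (h.1 (star f)) KOp.p₀)) = KA.mk (h.1 f) KOp.p₀
  rw [KA.ψ_mk, KA.map_mk, KOp.ψ_p₀, KOp.map_p₀, ← hh]

lemma KR.act_η_zero : KR.act (KR.η ((0 : V) : OnePoint V)) = KR.η ((0 : V) : OnePoint V) := by
  rw [← KR.η_equivariant]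
  exact congrArg (fun v : V => KR.η (v : OnePoint V)) (map_zero V.τ)

/-- The end of the nullhomotopy: evaluation at infinity is the zero character. -/
lemma IsOddSymmetry.ofCl_hom_infty {ω : Cl V} (hω : IsOddSymmetry ω) :
    KR.ofCl (hω.hom (evalAt OnePoint.infty)) = 0 := by
  refine Subtype.ext (DFunLike.ext _ _ fun f => ?_)
  rw [KR.ofCl_apply, hω.hom_apply, evalAt_infty, evalAt_infty, add_zero, sub_zero, zero_div,
    zero_smul, zero_smul, add_zero]
  exact map_zero KA.mkP₀

/-- The start of the nullhomotopy: odd functions vanish at `0`, so the coefficient of `ω`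
disappears. -/
lemma IsOddSymmetry.ofCl_hom_zero {ω : Cl V} (hω : IsOddSymmetry ω) :
    KR.ofCl (hω.hom (evalAt ((0 : ℝ) : OnePoint ℝ))) = KR.η ((0 : V) : OnePoint V) := by
  refine Subtype.ext (DFunLike.ext _ _ fun f => ?_)
  rw [KR.η_zero_apply, KR.ofCl_apply, hω.hom_apply]
  simp

end Points

/-! ### Classes of maps out of the sphere of a trivial vector space -/

section PointMaps

variable {U W : CRep} [Subsingleton U]

instance : Subsingleton CRep.zero := inferInstanceAs (Subsingleton (EuclideanSpace ℝ (Fin 0)))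

instance {U' : CRep} [Subsingleton U'] : Subsingleton (CRep.sum U U') :=
  ⟨fun _ _ => WithLp.ofLp_injective 2 (Prod.ext (Subsingleton.elim (α := U) _ _)
    (Subsingleton.elim (α := U') _ _))⟩

/-- The sphere of a trivial vector space consists of the two points `0` and `∞`. Maps out of it are
automatically continuous. -/
instance : DiscreteTopology (OnePoint U) := by
  have : Finite (OnePoint U) := inferInstanceAs (Finite (Option U))
  infer_instance

/-- The equivariant based map `S⁰ → KR(U ⊕ W)` with a given fixed point as its value. -/
def EqMap.ofPoint (h : KR (CRep.sum U W)) (hh : KR.act h = h) : EqMap U W where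
  toFun x := x.elim 0 fun _ => h
  continuous := continuous_of_discreteTopology
  map_infty := rfl
  equivariant x := by
    induction x using OnePoint.rec with
    | infty => exact KR.act_zero.symm
    | coe u => exact hh.symm

/-- The map that represents the product of pre-Euler classes. -/
abbrev EqMap.η₀ (U W : CRep) [Subsingleton U] : EqMap U W :=
  EqMap.ofPoint (KR.η ((0 : CRep.sum U W) : OnePoint (CRep.sum U W))) KR.act_η_zero

lemma EqMap.ext {f g : EqMap U W} (h : f.toFun = g.toFun) : f = g := by
  cases f
  cases g
  congr

/-- The only finite point of the source is `0`, and the inclusion sends it to `0`. -/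
lemma preEuler_eq (W : CRep) : preEuler W = (EqMap.η₀ CRep.zero W).cls := by
  refine congrArg EqMap.cls (EqMap.ext (funext fun x => ?_))
  induction x using OnePoint.rec with
  | infty => rfl
  | coe u =>
    have : inl CRep.zero W u = 0 := by rw [Subsingleton.elim u 0, map_zero]
    exact congrArg (fun v : CRep.sum CRep.zero W => KR.η (OnePoint.some v)) this

/-- The three representatives satisfy the product relation on the nose: each has the value `η(0)` at
the finite point, and interchanging summands preserves this value. -/
lemma EqMap.isMul_η₀ {U' W' : CRep} [Subsingleton U'] :
    IsMul (EqMap.η₀ U W).cls (EqMap.η₀ U' W').cls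
      (EqMap.η₀ (CRep.sum U U') (CRep.sum W W')).cls := by
  refine ⟨U, U', _, _, _, rfl, rfl, rfl, fun u u' => ?_⟩
  have h : KR.map (interchange U U' W W')
      (KR.η ((0 : OSum (OSum U U') (OSum W W')) : OnePoint (OSum (OSum U U') (OSum W W')))) =
      KR.η ((0 : OSum (OSum U W) (OSum U' W')) : OnePoint (OSum (OSum U W) (OSum U' W'))) :=
    KR.map_η_zero _
  have h' : IsGradedProduct (KR.η ((0 : OSum U W) : OnePoint (OSum U W)))
      (KR.η ((0 : OSum U' W') : OnePoint (OSum U' W'))) (KR.map (interchange U U' W W')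
      (KR.η ((0 : OSum (OSum U U') (OSum W W')) : OnePoint (OSum (OSum U U') (OSum W W'))))) := by
    rw [h]
    exact isGradedProduct_η_zero
  exact h'

/-- The zero class is defined on the sphere of `CRep.zero`; the isometry from any other trivial
space carries the constant map to it. -/
lemma EqMap.cls_ofPoint_zero :
    (EqMap.ofPoint (0 : KR (CRep.sum U W)) KR.act_zero).cls = 0 := by
  let φ : U ≃ₗᵢ[ℝ] CRep.zero :=
    { (0 : U →ₗ[ℝ] CRep.zero) with
      invFun := 0
      left_inv := fun _ => Subsingleton.elim _ _
      right_inv := fun _ => Subsingleton.elim _ _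
      norm_map' := fun u => by
        rw [Subsingleton.elim u 0]
        exact (congrArg norm (Subsingleton.elim _ (0 : CRep.zero))).trans (by simp) }
  refine Quot.sound (EqMap.Rel.transport φ (fun _ => Subsingleton.elim _ _) _ _ fun x => ?_)
  have h : (EqMap.ofPoint (0 : KR (CRep.sum U W)) KR.act_zero).toFun x = 0 := by
    induction x using OnePoint.rec <;> rfl
  rw [h]
  refine Subtype.ext (DFunLike.ext _ _ fun f => ?_)
  exact (map_zero (KA.map (LinearIsometryEquiv.withLpProdCongr 2 φ
    (LinearIsometryEquiv.refl ℝ W)))).symm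

/-- Three orthonormal vectors on which the generator of `C` acts by the sign give a nullhomotopy. -/
lemma EqMap.cls_η₀_eq_zero {v : Fin 3 → CRep.sum U W} (hv : Orthonormal ℝ v)
    (hτ : ∀ i, (CRep.sum U W).τ (v i) = -v i) : (EqMap.η₀ U W).cls = 0 := by
  -- A homotopy relates maps out of the same sphere, so zero is first represented on `S^U`.
  rw [← EqMap.cls_ofPoint_zero (U := U)]
  have hω := Cl.vol_isOddSymmetry hv
  let γ : Path ((0 : ℝ) : OnePoint ℝ) OnePoint.infty := PathConnectedSpace.somePath _ _
  -- The path of points of `ℝ ∪ {∞}` becomes a path of characters and, through the volume element, a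
  -- path of fixed points of `KR(U ⊕ W)`.
  let H : unitInterval → EqMap U W := fun s => EqMap.ofPoint (KR.ofCl (hω.hom (evalAt (γ s))))
    (KR.act_ofCl (hω.hom_fixed (Cl.vol_fixed hτ) _))
  refine Quot.sound (EqMap.Rel.homotopy _ _ H ?_ ?_ ?_)
  -- As `S^U` is discrete, joint continuity is continuity in the homotopy parameter at each of its
  -- two points.
  · rw [continuous_prod_of_discrete_right]
    intro x
    induction x using OnePoint.rec with
    | infty => exact continuous_const
    | coe u => exact KR.continuous_ofCl.comp (hω.continuous_hom_evalAt.comp γ.continuous)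
  · funext x
    induction x using OnePoint.rec with
    | infty => rfl
    | coe u =>
      change KR.ofCl (hω.hom (evalAt (γ 0))) = _
      rw [γ.source]
      exact hω.ofCl_hom_zero
  · funext x
    induction x using OnePoint.rec with
    | infty => rfl
    | coe u =>
      change KR.ofCl (hω.hom (evalAt (γ 1))) = _
      rw [γ.target]
      exact hω.ofCl_hom_infty

end PointMaps

end KRSpec
end

/-! ### The cube of the pre-Euler class -/

theorem mainTheorem12 :
    (∃ b : KRSpec.Pi (KRSpec.CRep.sum KRSpec.CRep.sign KRSpec.CRep.sign),
      KRSpec.IsMul (KRSpec.preEuler KRSpec.CRep.sign) (KRSpec.preEuler KRSpec.CRep.sign) b ∧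
      KRSpec.IsMul b (KRSpec.preEuler KRSpec.CRep.sign) 0) ∧
    Nonempty (KRSpec.FixedPoints (KRSpec.CRep.sum
      (KRSpec.CRep.sum KRSpec.CRep.sign KRSpec.CRep.sign) KRSpec.CRep.sign) ≃ₜ Circle) := by
  -- The square `a²` is represented by `η(0)` on the sphere of `0 ⊕ 0`.
  refine ⟨⟨(KRSpec.EqMap.η₀ (KRSpec.CRep.sum KRSpec.CRep.zero KRSpec.CRep.zero) _).cls, ?_, ?_⟩,
    KRSpec.fixedPoints_homeomorph_circle⟩
  · rw [KRSpec.preEuler_eq]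
    exact KRSpec.EqMap.isMul_η₀
  -- Zero is rewritten as the class of `η(0)` on the sphere of `(0 ⊕ 0) ⊕ 0`, which visibly is the
  -- product. The three orthonormal vectors are a basis of `3σ`, placed in the second summand of `U
  -- ⊕ 3σ`; there the action is `-1`, and the first coordinates agree because `U` is trivial.
  · rw [KRSpec.preEuler_eq, ← KRSpec.EqMap.cls_η₀_eq_zero
      (U := KRSpec.CRep.sum (KRSpec.CRep.sum KRSpec.CRep.zero KRSpec.CRep.zero) KRSpec.CRep.zero)
      (W := KRSpec.CRep.sign₃) (KRSpec.CRep.sign₃Basis.orthonormal.comp_linearIsometry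
        (KRSpec.inr (KRSpec.CRep.sum (KRSpec.CRep.sum KRSpec.CRep.zero KRSpec.CRep.zero)
          KRSpec.CRep.zero) KRSpec.CRep.sign₃))
      fun i => WithLp.ofLp_injective 2 (Prod.ext (Subsingleton.elim _ _) rfl)]
    exact KRSpec.EqMap.isMul_η₀
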